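/- Let $g,\mathcal G,\lambda>0$ and $k\ge 0$ be constants and let $z_b:\mathbb R^2\to\mathbb R$ be a differentiable topography. For fields $H>0$ (scalar), $\boldsymbol U\in\mathbb R^2$, $\boldsymbol F\in\mathbb R^{2\times2}$ invertible (entries $F^i_\alpha$, row $i$, column $\alpha$), $\boldsymbol A\in\mathbb R^{2\times 2}$ symmetric positive definite and $A^{cc}>0$ of $(t,x)\in\mathbb R\times\mathbb R^2$, consider the 2D Saint-Venant–Maxwell system $$\text{(SVM)}\quad\begin{aligned} &\partial_t(HU^i)+\partial_j\big(HU^iU^j+(\tfrac g2H^2+\mathcal G A^{cc}H^3)\delta_{ij}-\mathcal G H(\boldsymbol F\boldsymbol A\boldsymbol F^T)^{ij}\big)=-gH\partial_iz_b-kHU^i,\\ &\partial_tH+\partial_j(HU^j)=0,\qquad \partial_t(HF^i_\alpha)+\partial_j(HU^jF^i_\alpha-HF^j_\alpha U^i)=0,\\ &\partial_t(H\boldsymbol A)+\partial_j(HU^j\boldsymbol A)=H\big((\boldsymbol F^T\boldsymbol F)^{-1}-\boldsymbol A\big)/\lambda,\qquad \partial_t(HA^{cc})+\partial_j(HU^jA^{cc})=H(H^{-2}-A^{cc})/\lambda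 , \end{aligned}$$ and the system (SVM1) for $q=(H,H\boldsymbol U,H\boldsymbol F,H\boldsymbol Y,HY^{cc})\in\mathbb R^{11}$, with $\boldsymbol Y$ symmetric positive definite and $Y^{cc}>0$, which consists of the first three equations of (SVM) with $\boldsymbol A=\boldsymbol Y^{-1/2}$, $A^{cc}=(Y^{cc})^4$, and of $$\begin{aligned} &\partial_t(H\boldsymbol Y)+\partial_j(HU^j\boldsymbol Y)=-H\,\boldsymbol Y(\boldsymbol Z-2\boldsymbol Y^{-1})\boldsymbol Y/\lambda,\qquad \boldsymbol Z=(\boldsymbol F^T\boldsymbol F)^{-1}\boldsymbol A+\boldsymbol A(\boldsymbol F^T\boldsymbol F)^{-1},\\ &\partial_t(HY^{cc})+\partial_j(HU^jY^{cc})=H\big(H^{-2}(Y^{cc})^{-3}-Y^{cc}\big)/(4\lambda). \end{aligned}$$ Let $\mathcal A^+_H=\{q: H>0,\ \boldsymbol Y=\boldsymbol Y^T>0,\ Y^{cc}>0\}\subset\mathbb R^{11}$, where a symmetric matrix is represented by its three coefficients. Put $\boldsymbol\Sigma^H=\mathcal G\boldsymbol F\boldsymbol A\boldsymbol F^T$,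 $\Sigma^{zz}=\mathcal GA^{cc}H^2$ and $$\tilde E=\tfrac H2\big(|\boldsymbol U|^2+gH+\operatorname{tr}\boldsymbol\Sigma^H+\Sigma^{zz}+\operatorname{tr}(\boldsymbol Y\boldsymbol Y)\big).$$ 1. For every open $O\subset\mathbb R\times\mathbb R^2$ and every $n\in\{1,2,\dots,\infty\}$, the map $q\mapsto(H,\boldsymbol U,\boldsymbol F,\boldsymbol A,A^{cc})$ with $\boldsymbol A=\boldsymbol Y^{-1/2}$, $A^{cc}=(Y^{cc})^4$ is a bijection from the $C^n$ solutions of (SVM1) on $O$ to the $C^n$ solutions of (SVM) on $O$. For every $\hat H>0$ it restricts to a bijection between the solutions which satisfy the Piola identities $\sum_j\partial_j(HF^j_\alpha)=0$ ($\alpha=1,2$) and $H\det\boldsymbol F=\hat H$. 2. $\mathcal A^+_H$ is open; the same map is a bijection from $\mathcal A^+_H$ onto $\{H>0,\ \boldsymbol A=\boldsymbol A^T>0,\ A^{cc}>0\}$; and $\tilde E$ is strictly convex in $q\in\mathcal A^+_H$. 3. Every $C^1$ solution of (SVM1) on an open set $O$ which satisfies the Piola identities on $O$ satisfies $$\partial_t\tilde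 E+\operatorname{div}\big(\boldsymbol U(\tilde E+\tfrac g2H^2)+H(\Sigma^{zz}\boldsymbol I-\boldsymbol\Sigma^H)\boldsymbol U\big)=-kH|\boldsymbol U|^2-gH\,\boldsymbol U\cdot\nabla z_b-H\tilde D ,$$ where $\tilde D=\frac1{2\lambda}(\operatorname{tr}\boldsymbol\Sigma^H+\Sigma^{zz}-3\mathcal G)+\frac1\lambda\operatorname{tr}\big(\boldsymbol Y\,\boldsymbol Y(\boldsymbol Z-2\boldsymbol Y^{-1})\boldsymbol Y\big)$. For every $\hat H>0$, $\tilde D$ takes both signs on the states of $\mathcal A_H^+$ with $H\det\boldsymbol F=\hat H$. 4. Write (SVM1) as $\partial_tq+\sum_j\partial_jF_j(q)=B$, and the Piola identities as $\sum_jM_j\partial_jq=0$, where $M_jq=(HF^j_\alpha)_{\alpha}$. The Piola identities are an involution of (SVM1): $M_iF_j+M_jF_i=0$ and $M_jB=0$ on $\mathcal A^+_H$. With the constraint of this involution, $\tilde E$ is a (strictly convex) mathematical entropy of (SVM1) on $\mathcal A_H^+$: it is smooth and, with $Q_j$ the (smooth) fluxes of the balance law in 3, $D\tilde E\,DF_j=DQ_j+\Xi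 M_j$ on $\mathcal A_H^+$ for some smooth $\Xi:\mathcal A_H^+\to(\mathbb R^2)^*$. And (SVM1) is symmetric-hyperbolic on $\mathcal A^+_H$ with symmetrizer $D^2\tilde E$: the $F_j$ are smooth, $D^2\tilde E(q)$ is symmetric positive definite and depends smoothly on $q$, and, for some smooth $C(q):\mathbb R^2\to\mathbb R^{11}$ such that (SVM1) reads $\partial_tq+\sum_j(DF_j-C M_j)\partial_jq=B$ for fields which satisfy the Piola identities, all $D^2\tilde E\,(DF_j-C M_j)$ are symmetric. -/

import Mathlib

open scoped Matrix ContDiff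

noncomputable section

/-! ### Space-time and state vectors -/

/-- Space-time points `(t, x)`, with `t ∈ ℝ` and `x ∈ ℝ²`. -/
abbrev SpaceTime : Type := ℝ × (Fin 2 → ℝ)

/-- The time derivative of a field. -/
def dt {E : Type*} [NormedAddCommGroup E] [NormedSpace ℝ E] (f : SpaceTime → E)
    (x : SpaceTime) : E :=
  fderiv ℝ f x (1, 0)

/-- The derivative of a field in the `j`-th horizontal direction. -/
def dx {E : Type*} [NormedAddCommGroup E] [NormedSpace ℝ E] (j : Fin 2) (f : SpaceTime → E)
    (x : SpaceTime) : E :=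
  fderiv ℝ f x (0, Pi.single j 1)

/-- State vectors in `ℝ¹¹`: a depth, a vector (2 entries), a matrix (4 entries, the row is the
spatial index and the column the material index), a symmetric matrix `!![s 0, s 1; s 1, s 2]`
(3 entries) and a scalar. Both the variables `(H, U, F, A, Acc)` and the conserved variables
`(H, HU, HF, HY, HYcc)` are of this form. -/
abbrev SvmState : Type := ℝ × (Fin 2 → ℝ) × (Fin 2 → Fin 2 → ℝ) × (Fin 3 → ℝ) × ℝ

namespace SvmState

/-- The first entry. -/
def depth (p : SvmState) : ℝ := p.1

/-- The vector entry. -/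
def vec (p : SvmState) : Fin 2 → ℝ := p.2.1

/-- The matrix entry. -/
def mat (p : SvmState) : Matrix (Fin 2) (Fin 2) ℝ := Matrix.of p.2.2.1

/-- The three coefficients of the symmetric matrix entry. -/
def symCoeff (p : SvmState) : Fin 3 → ℝ := p.2.2.2.1

/-- The symmetric matrix entry. -/
def sym (p : SvmState) : Matrix (Fin 2) (Fin 2) ℝ :=
  !![p.symCoeff 0, p.symCoeff 1; p.symCoeff 1, p.symCoeff 2]

/-- The last entry. -/
def scal (p : SvmState) : ℝ := p.2.2.2.2

end SvmState

/-- The coefficients of a symmetric matrix. -/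
def symEntries (S : Matrix (Fin 2) (Fin 2) ℝ) : Fin 3 → ℝ := ![S 0 0, S 0 1, S 1 1]

/-- The inverse square root of a symmetric positive definite matrix (functional calculus). -/
def matInvSqrt (Y : Matrix (Fin 2) (Fin 2) ℝ) : Matrix (Fin 2) (Fin 2) ℝ :=
  cfc (fun t : ℝ => t ^ (-(1 / 2) : ℝ)) Y

/-! ### The system in the variables `p = (H, U, F, A, Acc)` -/

/-- Admissible values of `(H, U, F, A, Acc)`. -/
def SvmAdmissible : Set SvmState :=
  {p | 0 < p.depth ∧ p.sym.PosDef ∧ 0 < p.scal}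

/-- The conserved quantities `(H, HU, HF, HA, HAcc)`. -/
def svmConserved (p : SvmState) : SvmState :=
  (p.depth, fun i => p.depth * p.vec i, fun i α => p.depth * p.mat i α,
    fun l => p.depth * p.symCoeff l, p.depth * p.scal)

/-- The horizontal stress `Σᴴ = G F A Fᵀ`. -/
def stressH (G : ℝ) (p : SvmState) : Matrix (Fin 2) (Fin 2) ℝ :=
  G • (p.mat * p.sym * p.matᵀ)

/-- The vertical stress `Σᶻᶻ = G Acc H²`. -/
def stressZZ (G : ℝ) (p : SvmState) : ℝ := G * p.scal * p.depth ^ 2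

/-- The momentum flux
`H U ⊗ U + (g H² / 2 + G Acc H³) I - G H F A Fᵀ`. -/
def momentumFlux (g G : ℝ) (p : SvmState) : Matrix (Fin 2) (Fin 2) ℝ :=
  p.depth • Matrix.vecMulVec p.vec p.vec
    + (g / 2 * p.depth ^ 2 + G * p.scal * p.depth ^ 3) • (1 : Matrix (Fin 2) (Fin 2) ℝ)
    - (G * p.depth) • (p.mat * p.sym * p.matᵀ)

/-- The `j`-th flux in the equations for `(H, HU, HF, HA, HAcc)`. -/
def svmFlux (g G : ℝ) (j : Fin 2) (p : SvmState) : SvmState :=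
  (p.depth * p.vec j, fun i => momentumFlux g G p i j,
    fun i α => p.depth * p.vec j * p.mat i α - p.depth * p.mat j α * p.vec i,
    fun l => p.depth * p.vec j * p.symCoeff l, p.depth * p.vec j * p.scal)

/-- The source in the equations for `(H, HU, HF, HA, HAcc)`, for a topography of slope `s`. -/
def svmSource (g k lam : ℝ) (s : Fin 2 → ℝ) (p : SvmState) : SvmState :=
  (0, fun i => -g * p.depth * s i - k * p.depth * p.vec i, 0,
    symEntries ((p.depth / lam) • ((p.matᵀ * p.mat)⁻¹ - p.sym)),
    p.depth * (1 / p.depth ^ 2 - p.scal) / lam)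

/-- The gradient of the topography. -/
def topoSlope (zb : (Fin 2 → ℝ) → ℝ) (x : SpaceTime) : Fin 2 → ℝ :=
  fun i => fderiv ℝ zb x.2 (Pi.single i 1)

/-- `p = (H, U, F, A, Acc)` is a solution of class `C^n` on the open set `O` of the
Saint-Venant-Maxwell system, with `H > 0`, `F` invertible, `A` symmetric positive definite
and `Acc > 0`. -/
structure IsSvmSolution (g G k lam : ℝ) (zb : (Fin 2 → ℝ) → ℝ) (n : ℕ∞) (O : Set SpaceTime)
    (p : SpaceTime → SvmState) : Prop where
  smooth : ContDiffOn ℝ n p O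
  admissible : ∀ x ∈ O, p x ∈ SvmAdmissible
  invertible : ∀ x ∈ O, (p x).mat.det ≠ 0
  equation : ∀ x ∈ O,
    dt (fun y => svmConserved (p y)) x + ∑ j, dx j (fun y => svmFlux g G j (p y)) x
      = svmSource g k lam (topoSlope zb x) (p x)

/-! ### The system in the conserved variables `q = (H, HU, HF, HY, HYcc)` -/

/-- `(H, U, F, Y, Ycc)` as a function of `q = (H, HU, HF, HY, HYcc)`. -/
def primY (q : SvmState) : SvmState :=
  (q.depth, fun i => q.vec i / q.depth, fun i α => q.mat i α / q.depth,
    fun l => q.symCoeff l / q.depth, q.scal / q.depth)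

/-- `(H, U, F, A, Acc)` as a function of `q = (H, HU, HF, HY, HYcc)`, where `A = Y^(-1/2)` and
`Acc = Ycc⁴`. -/
def primA (q : SvmState) : SvmState :=
  (q.depth, (primY q).vec, (primY q).mat, symEntries (matInvSqrt (primY q).sym),
    (primY q).scal ^ 4)

/-- The state domain `H > 0`, `Y = Yᵀ > 0`, `Ycc > 0`, as a set of vectors
`q = (H, HU, HF, HY, HYcc)`. -/
def AHPlus : Set SvmState :=
  {q | 0 < q.depth ∧ (primY q).sym.PosDef ∧ 0 < (primY q).scal}

/-- The `j`-th flux of the system for `q`. -/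
def svm1Flux (g G : ℝ) (j : Fin 2) (q : SvmState) : SvmState :=
  (q.vec j, fun i => momentumFlux g G (primA q) i j,
    fun i α => (primA q).vec j * q.mat i α - q.mat j α * (primA q).vec i,
    fun l => (primA q).vec j * q.symCoeff l, (primA q).vec j * q.scal)

/-- `Z = (Fᵀ F)⁻¹ A + A (Fᵀ F)⁻¹`. -/
def matZ (q : SvmState) : Matrix (Fin 2) (Fin 2) ℝ :=
  ((primA q).matᵀ * (primA q).mat)⁻¹ * (primA q).sym
    + (primA q).sym * ((primA q).matᵀ * (primA q).mat)⁻¹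

/-- `Y (Z - 2 Y⁻¹) Y`. -/
def relaxY (q : SvmState) : Matrix (Fin 2) (Fin 2) ℝ :=
  (primY q).sym * (matZ q - (2 : ℝ) • ((primY q).sym)⁻¹) * (primY q).sym

/-- The source of the system for `q`, for a topography of slope `s`. -/
def svm1Source (g k lam : ℝ) (s : Fin 2 → ℝ) (q : SvmState) : SvmState :=
  (0, fun i => -g * q.depth * s i - k * q.vec i, 0,
    symEntries (-(q.depth / lam) • relaxY q),
    q.depth * (1 / (q.depth ^ 2 * (primY q).scal ^ 3) - (primY q).scal) / (4 * lam))

/-- `q = (H, HU, HF, HY, HYcc)` is a solution of class `C^n` on the open set `O` of the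
conservative system, with values in `AHPlus` and with `F` invertible. -/
structure IsSvm1Solution (g G k lam : ℝ) (zb : (Fin 2 → ℝ) → ℝ) (n : ℕ∞) (O : Set SpaceTime)
    (q : SpaceTime → SvmState) : Prop where
  smooth : ContDiffOn ℝ n q O
  admissible : ∀ x ∈ O, q x ∈ AHPlus
  invertible : ∀ x ∈ O, (primY (q x)).mat.det ≠ 0
  equation : ∀ x ∈ O,
    dt q x + ∑ j, dx j (fun y => svm1Flux g G j (q y)) x
      = svm1Source g k lam (topoSlope zb x) (q x)

/-! ### Solutions as functions on `O`, and the constraints satisfied by motions -/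

/-- The set of `C^n` solutions `(H, U, F, A, Acc) : O → ℝ¹¹`. -/
def SvmSolutions (g G k lam : ℝ) (zb : (Fin 2 → ℝ) → ℝ) (n : ℕ∞) (O : Set SpaceTime) :
    Set (O → SvmState) :=
  O.domRestrict '' {p | IsSvmSolution g G k lam zb n O p}

/-- The set of `C^n` solutions `(H, HU, HF, HY, HYcc) : O → ℝ¹¹`. -/
def Svm1Solutions (g G k lam : ℝ) (zb : (Fin 2 → ℝ) → ℝ) (n : ℕ∞) (O : Set SpaceTime) :
    Set (O → SvmState) :=
  O.domRestrict '' {q | IsSvm1Solution g G k lam zb n O q}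

/-- The two-dimensional Piola identities `∂ⱼ (H Fʲ_α) = 0` for a matrix field `W = H F`. -/
def PiolaOn (O : Set SpaceTime) (W : SpaceTime → Matrix (Fin 2) (Fin 2) ℝ) : Prop :=
  ∀ x ∈ O, ∀ α, ∑ j, dx j (fun y => W y j α) x = 0

/-- The solutions `(H, U, F, A, Acc)` which satisfy the Piola identities and `H |F| = Hhat`. -/
def SvmMotions (g G k lam : ℝ) (zb : (Fin 2 → ℝ) → ℝ) (Hhat : ℝ) (n : ℕ∞)
    (O : Set SpaceTime) : Set (O → SvmState) :=
  O.domRestrict '' {p | IsSvmSolution g G k lam zb n O p ∧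
    PiolaOn O (fun y => (p y).depth • (p y).mat) ∧
    ∀ x ∈ O, (p x).depth * (p x).mat.det = Hhat}

/-- The solutions `(H, HU, HF, HY, HYcc)` which satisfy the Piola identities and
`H |F| = Hhat`. -/
def Svm1Motions (g G k lam : ℝ) (zb : (Fin 2 → ℝ) → ℝ) (Hhat : ℝ) (n : ℕ∞)
    (O : Set SpaceTime) : Set (O → SvmState) :=
  O.domRestrict '' {q | IsSvm1Solution g G k lam zb n O q ∧
    PiolaOn O (fun y => (q y).mat) ∧
    ∀ x ∈ O, (q x).depth * (primY (q x)).mat.det = Hhat}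

/-! ### The functional and its balance law -/

/-- `H / 2 (|U|² + g H + tr Σᴴ + Σᶻᶻ + tr (Y Y))` as a function of `q`. -/
def svmEnergy (g G : ℝ) (q : SvmState) : ℝ :=
  q.depth / 2 * (∑ i, (primA q).vec i ^ 2 + g * q.depth
    + ((stressH G (primA q)).trace + stressZZ G (primA q)
      + ((primY q).sym * (primY q).sym).trace))

/-- The `j`-th component of `U (E + g H² / 2) + H (Σᶻᶻ I - Σᴴ) U`, with `E` the energy. -/
def svmEnergyFlux (g G : ℝ) (j : Fin 2) (q : SvmState) : ℝ :=
  (primA q).vec j * (svmEnergy g G q + g / 2 * q.depth ^ 2)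
    + q.depth * ((stressZZ G (primA q) • (1 : Matrix (Fin 2) (Fin 2) ℝ)
        - stressH G (primA q)) *ᵥ (primA q).vec) j

/-- The algebraic source term
`(tr Σᴴ + Σᶻᶻ - 3 G) / (2 λ) + tr (Y (Y (Z - 2 Y⁻¹) Y)) / λ`. -/
def svmDissipation (G lam : ℝ) (q : SvmState) : ℝ :=
  ((stressH G (primA q)).trace + stressZZ G (primA q) - 3 * G) / (2 * lam)
    + ((primY q).sym * relaxY q).trace / lam

/-! ### Systems of conservation laws with an involution

We consider `∂ₜ q + ∑ⱼ ∂ⱼ (F j q) = B s q`, `q ∈ D ⊆ E`, together with a linear constraint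
`∑ⱼ M j (∂ⱼ q) = 0`. -/

section Involution

variable {E W P : Type*} [NormedAddCommGroup E] [NormedSpace ℝ E]
  [NormedAddCommGroup W] [NormedSpace ℝ W]

/-- `∑ⱼ M j (∂ⱼ q) = 0` is an involution, that is, `∂ₜ ∑ⱼ M j (∂ⱼ q) = 0` follows from the system
because the second derivatives of the fluxes cancel and the source does not contribute. -/
def IsInvolution (F : Fin 2 → E → E) (B : P → E → E) (M : Fin 2 → E →L[ℝ] W) (D : Set E) :
    Prop :=
  (∀ q ∈ D, ∀ i j, M i (F j q) + M j (F i q) = 0) ∧ ∀ s, ∀ q ∈ D, ∀ j, M j (B s q) = 0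

/-- `η` is an entropy with entropy fluxes `Q j` on `D`, for the system with its constraint:
`Dη DFⱼ = DQⱼ` up to a combination `Ξ(q) ∘ Mⱼ` of the constraint, so that
`∂ₜ η(q) + ∑ⱼ ∂ⱼ Qⱼ(q) = Dη(q) B` for all smooth solutions with `∑ⱼ M j (∂ⱼ q) = 0`. -/
def IsEntropyPair (F : Fin 2 → E → E) (M : Fin 2 → E →L[ℝ] W) (D : Set E) (η : E → ℝ)
    (Q : Fin 2 → E → ℝ) : Prop :=
  ContDiffOn ℝ ∞ η D ∧ (∀ j, ContDiffOn ℝ ∞ (Q j) D) ∧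
    ∃ Ξ : E → W →L[ℝ] ℝ, ContDiffOn ℝ ∞ Ξ D ∧ ∀ q ∈ D, ∀ j,
      (fderiv ℝ η q).comp (fderiv ℝ (F j) q) = fderiv ℝ (Q j) q + (Ξ q).comp (M j)

/-- The system with its constraint is symmetric-hyperbolic on `D`, with symmetrizer `S`: the
fluxes and `S` are smooth, each `S q` is a symmetric positive definite bilinear form, and on
adding to the system a multiple `-C(q) ∑ⱼ M j (∂ⱼ q)` of the constraint one gets a quasilinear
system `∂ₜ q + ∑ⱼ Aⱼ(q) ∂ⱼ q = B`, `Aⱼ = DFⱼ - C Mⱼ`, such that all `S Aⱼ` are symmetric. -/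
def IsSymmetricHyperbolic (F : Fin 2 → E → E) (M : Fin 2 → E →L[ℝ] W) (D : Set E)
    (S : E → E →L[ℝ] E →L[ℝ] ℝ) : Prop :=
  (∀ j, ContDiffOn ℝ ∞ (F j) D) ∧ ContDiffOn ℝ ∞ S D ∧
    (∀ q ∈ D, ∀ v w, S q v w = S q w v) ∧ (∀ q ∈ D, ∀ v, v ≠ 0 → 0 < S q v v) ∧
    ∃ C : E → W →L[ℝ] E, ContDiffOn ℝ ∞ C D ∧ ∀ q ∈ D, ∀ j v w,
      S q (fderiv ℝ (F j) q v - C q (M j v)) w = S q (fderiv ℝ (F j) q w - C q (M j w)) v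

end Involution

/-- The Piola constraint as a linear constraint on `q = (H, HU, HF, HY, HYcc)`: the `j`-th map
takes `q` to the `j`-th row of `H F`. -/
def piolaMap (j : Fin 2) : SvmState →L[ℝ] (Fin 2 → ℝ) :=
  (ContinuousLinearMap.proj (R := ℝ) (φ := fun _ : Fin 2 => Fin 2 → ℝ) j).comp
    ((ContinuousLinearMap.fst ℝ (Fin 2 → Fin 2 → ℝ) ((Fin 3 → ℝ) × ℝ)).comp
      ((ContinuousLinearMap.snd ℝ (Fin 2 → ℝ) _).comp (ContinuousLinearMap.snd ℝ ℝ _)))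

end

noncomputable section

/-! For 2×2 matrices the square root has a closed form, so `Y ↦ Y^(-1/2)` is a smooth bijection of
the positive definite cone with inverse `A ↦ A⁻²`. Differentiating `A A Y = 1` gives a Lyapunov
equation for the variation of `A`, and the Lyapunov operator of a positive definite matrix is
injective. Hence linear relaxation of `A` towards `(FᵀF)⁻¹` is equivalent to the stated equation for
`Y` (`fderiv_invSqrtCoeff_eq_iff`). The variables `A` and `Y` are both merely advected by the
fluxes, so the differential of the change of variables carries one system to the other pointwise
(`svm_equation_iff`).

Strict convexity comes from a positive definite Hessian. With `m = HU`, `W = HF`, `R = HY`, `s = H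
Ycc`, the functional is `g H²/2 + (|m|² + tr(RR) + G s⁴)/(2H)` plus `G/2` times the sum over the
rows `w` of `W` of `w ⬝ K⁻¹ w`, where `K = H A⁻¹ = (H R)^(1/2)`. The first terms give explicit
squares. In the last, `K` is a geometric mean of `H I` and `R`, so it is concave: along a line,
`-K''` solves a Lyapunov equation whose right-hand side is twice a square
(`sqrt_second_deriv_nonpos`). The map `(w, K) ↦ w ⬝ K⁻¹ w` is jointly convex and decreases with `K`;
quantitatively its second derivative is `2 γ' ⬝ K γ' - γ ⬝ K'' γ` with `γ = K⁻¹ w`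
(`row_second_deriv`).

The relation `Dη DFⱼ = DQⱼ + Ξ Mⱼ` is an algebraic identity (`energyDeriv_fluxDeriv`); the part of
the flux of `HF` which contains `U F` with exchanged indices leaves the multiple `Ξ` of the Piola
constraint. The balance law follows by applying `Dη` to the system: the constraint removes `Ξ`, and
the source is computed with `tr(F (FᵀF)⁻¹ Fᵀ) = 2`.

Symmetric hyperbolicity is the Godunov argument with a constraint
(`IsEntropyPair.isSymmetricHyperbolic`): one differentiates the compatibility relation once more,
antisymmetrizes, and chooses `C = (D²η)⁻¹ (DΞ)ᵀ` to absorb the derivative of `Ξ`. The lack of sign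
of the source is shown on states with `F = A = Y = I`. -/

/-! ### Symmetric matrices of order two and the inverse square root -/

/-- The symmetric matrix with given coefficients. -/
def symMat (y : Fin 3 → ℝ) : Matrix (Fin 2) (Fin 2) ℝ := !![y 0, y 1; y 1, y 2]

/-- Sylvester's criterion; the converse is the completion of the square after division by the first
pivot. -/
theorem symMat_posDef_iff (y : Fin 3 → ℝ) :
    (symMat y).PosDef ↔ 0 < y 0 ∧ 0 < y 0 * y 2 - y 1 ^ 2 := by
  constructor
  · intro h
    refine ⟨h.diag_pos (i := 0), ?_⟩
    have := h.det_pos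
    rw [symMat, Matrix.det_fin_two_of] at this
    linarith
  · rintro ⟨h0, h1⟩
    refine Matrix.PosDef.of_dotProduct_mulVec_pos ?_ ?_
    · ext i j
      fin_cases i <;> fin_cases j <;> simp [symMat]
    · intro v hv
      have key : star v ⬝ᵥ symMat y *ᵥ v
          = ((y 0 * v 0 + y 1 * v 1) ^ 2 + (y 0 * y 2 - y 1 ^ 2) * v 1 ^ 2) / y 0 := by
        simp [symMat, dotProduct, Matrix.mulVec, Fin.sum_univ_two]
        field_simp
        ring
      rw [key]
      apply div_pos _ h0
      by_cases hv1 : v 1 = 0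
      · have hv0 : v 0 ≠ 0 := by
          intro h
          apply hv
          ext i
          fin_cases i <;> assumption
        rw [hv1]
        have : 0 < (y 0 * v 0) ^ 2 := by positivity
        simpa using this
      · positivity

theorem symMat_posDef_trace_pos {y : Fin 3 → ℝ} (h : (symMat y).PosDef) :
    0 < y 0 + y 2 := add_pos (h.diag_pos (i := 0)) (h.diag_pos (i := 1))

theorem symMat_posDef_convex : Convex ℝ {y : Fin 3 → ℝ | (symMat y).PosDef} := by
  rw [convex_iff_forall_pos]
  intro x hx y hy a b ha hb _
  have : symMat (a • x + b • y) = a • symMat x + b • symMat y := by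
    ext i j
    fin_cases i <;> fin_cases j <;> simp [symMat]
  rw [Set.mem_ofPred_eq, this]
  exact (hx.smul ha).add (hy.smul hb)

theorem symMat_posDef_smul_iff {c : ℝ} (hc : 0 < c) (y : Fin 3 → ℝ) :
    (symMat (fun l => c * y l)).PosDef ↔ (symMat y).PosDef := by
  rw [symMat_posDef_iff, symMat_posDef_iff, mul_pos_iff_of_pos_left hc]
  have : c * y 0 * (c * y 2) - (c * y 1) ^ 2 = c ^ 2 * (y 0 * y 2 - y 1 ^ 2) := by ring
  rw [this, mul_pos_iff_of_pos_left (by positivity)]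

theorem Matrix.PosDef.spectrum_pos {A : Matrix (Fin 2) (Fin 2) ℝ} (hA : A.PosDef) {t : ℝ}
    (ht : t ∈ spectrum ℝ A) : 0 < t := by
  rw [hA.1.spectrum_real_eq_range_eigenvalues] at ht
  obtain ⟨i, rfl⟩ := ht
  exact hA.eigenvalues_pos i

/-- Both `(A A)⁻¹` and its inverse root are functions of `A` in the functional calculus, and
`(t⁻²)^(-1/2) = t` on the positive spectrum. Continuity is automatic because the spectrum is finite.
-/
theorem matInvSqrt_inv_mul_self {A : Matrix (Fin 2) (Fin 2) ℝ} (hA : A.PosDef) :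
    matInvSqrt (A * A)⁻¹ = A := by
  have hfin : ∀ (B : Matrix (Fin 2) (Fin 2) ℝ) (f : ℝ → ℝ), ContinuousOn f (spectrum ℝ B) :=
    fun B f => (Matrix.finite_real_spectrum (A := B)).continuousOn f
  have hs : IsSelfAdjoint A := hA.1
  have h1 : (A * A)⁻¹ = cfc (fun t : ℝ => (t ^ 2)⁻¹) A := by
    apply Matrix.inv_eq_right_inv
    have e : A * A = cfc (fun t : ℝ => t ^ 2) A := by
      rw [cfc_pow_id (R := ℝ) A 2 hs, pow_two]
    rw [e, ← cfc_mul _ _ A (hfin _ _) (hfin _ _)]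
    rw [cfc_congr (g := fun _ => (1 : ℝ)), cfc_const_one ℝ A]
    intro t ht
    have := hA.spectrum_pos ht
    simp only
    field_simp
  rw [matInvSqrt, h1, ← cfc_comp' (fun t : ℝ => t ^ (-(1 / 2) : ℝ)) (fun t : ℝ => (t ^ 2)⁻¹) A
    ((Set.Finite.image _ Matrix.finite_real_spectrum).continuousOn _) (hfin _ _) hs]
  conv_rhs => rw [← cfc_id' ℝ A hs]
  apply cfc_congr
  intro t ht
  have := hA.spectrum_pos ht
  simp only
  rw [Real.rpow_neg (by positivity), Real.inv_rpow (by positivity), inv_inv,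
    ← Real.sqrt_eq_rpow, Real.sqrt_sq this.le]

/-- The coefficients of the inverse square root of a symmetric matrix. -/
def invSqrtCoeff (y : Fin 3 → ℝ) : Fin 3 → ℝ := symEntries (matInvSqrt (symMat y))

/-- The coefficients of `A⁻²` as rational functions of those of `A`. -/
def invSqCoeff (a : Fin 3 → ℝ) : Fin 3 → ℝ :=
  ![(a 1 ^ 2 + a 2 ^ 2) / (a 0 * a 2 - a 1 ^ 2) ^ 2,
    -(a 1 * (a 0 + a 2)) / (a 0 * a 2 - a 1 ^ 2) ^ 2,
    (a 0 ^ 2 + a 1 ^ 2) / (a 0 * a 2 - a 1 ^ 2) ^ 2]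

theorem symMat_mul_self_mul_invSqCoeff {a : Fin 3 → ℝ} (ha : a 0 * a 2 - a 1 ^ 2 ≠ 0) :
    symMat a * symMat a * symMat (invSqCoeff a) = 1 := by
  ext i j
  fin_cases i <;> fin_cases j <;>
    simp [symMat, invSqCoeff, Matrix.mul_apply, Fin.sum_univ_two] <;> field_simp <;> ring

theorem symMat_invSqCoeff {a : Fin 3 → ℝ} (ha : a 0 * a 2 - a 1 ^ 2 ≠ 0) :
    symMat (invSqCoeff a) = (symMat a * symMat a)⁻¹ :=
  (Matrix.inv_eq_right_inv (symMat_mul_self_mul_invSqCoeff ha)).symm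

theorem symEntries_symMat (y : Fin 3 → ℝ) : symEntries (symMat y) = y := by
  ext l
  fin_cases l <;> simp [symEntries, symMat]

theorem invSqrtCoeff_invSqCoeff {a : Fin 3 → ℝ} (ha : (symMat a).PosDef) :
    invSqrtCoeff (invSqCoeff a) = a := by
  have h := ((symMat_posDef_iff a).1 ha).2
  rw [invSqrtCoeff, symMat_invSqCoeff h.ne', matInvSqrt_inv_mul_self ha, symEntries_symMat]

theorem symMat_invSqCoeff_posDef {a : Fin 3 → ℝ} (ha : (symMat a).PosDef) :
    (symMat (invSqCoeff a)).PosDef := by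
  obtain ⟨h0, h⟩ := (symMat_posDef_iff a).1 ha
  have h2 : 0 < a 2 := ha.diag_pos (i := 1)
  rw [symMat_posDef_iff]
  refine ⟨?_, ?_⟩
  · simp only [invSqCoeff, Matrix.cons_val_zero]
    positivity
  · have : invSqCoeff a 0 * invSqCoeff a 2 - invSqCoeff a 1 ^ 2
        = 1 / (a 0 * a 2 - a 1 ^ 2) ^ 2 := by
      have hne := h.ne'
      simp only [invSqCoeff, Matrix.cons_val]
      generalize hD : a 0 * a 2 - a 1 ^ 2 = D at hne ⊢
      field_simp
      rw [← hD]
      ring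
    rw [this]
    positivity

/-- Closed form of the coefficients of the inverse square root. -/
def invSqrtFormula (y : Fin 3 → ℝ) : Fin 3 → ℝ :=
  let d := Real.sqrt (y 0 * y 2 - y 1 ^ 2)
  let r := Real.sqrt (y 0 + y 2 + 2 * d)
  ![(y 2 + d) / (d * r), -y 1 / (d * r), (y 0 + d) / (d * r)]

/-- By Cayley-Hamilton `Y^(1/2) = (Y + d) / r` with `d = √det Y` and `r = √(tr Y + 2 d)`. Its
determinant is `d`, so its inverse is `(adj Y + d) / (d r)`, with determinant `1 / d`. -/
theorem invSqrtFormula_spec {y : Fin 3 → ℝ} (hy : (symMat y).PosDef) :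
    (symMat (invSqrtFormula y)).PosDef ∧ invSqCoeff (invSqrtFormula y) = y := by
  obtain ⟨h0, h⟩ := (symMat_posDef_iff y).1 hy
  have h2 : 0 < y 2 := hy.diag_pos (i := 1)
  obtain ⟨d, hd⟩ : ∃ d, d = Real.sqrt (y 0 * y 2 - y 1 ^ 2) := ⟨_, rfl⟩
  have hdpos : 0 < d := by rw [hd]; exact Real.sqrt_pos.2 h
  have hdsq : d ^ 2 = y 0 * y 2 - y 1 ^ 2 := by rw [hd]; exact Real.sq_sqrt h.le
  obtain ⟨r, hr⟩ : ∃ r, r = Real.sqrt (y 0 + y 2 + 2 * d) := ⟨_, rfl⟩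
  have hrpos : 0 < r := by rw [hr]; exact Real.sqrt_pos.2 (by positivity)
  have hrsq : r ^ 2 = y 0 + y 2 + 2 * d := by rw [hr]; exact Real.sq_sqrt (by positivity)
  have e : invSqrtFormula y = ![(y 2 + d) / (d * r), -y 1 / (d * r), (y 0 + d) / (d * r)] := by
    rw [hr, hd]; rfl
  have e0 : invSqrtFormula y 0 = (y 2 + d) / (d * r) := by rw [e]; rfl
  have e1 : invSqrtFormula y 1 = -y 1 / (d * r) := by rw [e]; rfl
  have e2 : invSqrtFormula y 2 = (y 0 + d) / (d * r) := by rw [e]; rfl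
  have hdet : invSqrtFormula y 0 * invSqrtFormula y 2 - invSqrtFormula y 1 ^ 2 = 1 / d := by
    rw [e0, e1, e2]
    field_simp
    rw [hrsq]
    linear_combination -hdsq
  refine ⟨?_, ?_⟩
  · rw [symMat_posDef_iff, hdet, e0]
    constructor <;> positivity
  · have hy1 : y 1 ^ 2 = y 0 * y 2 - d ^ 2 := by linarith
    ext l
    fin_cases l
    · simp only [invSqCoeff, hdet, Matrix.cons_val, Fin.zero_eta]
      rw [e1, e2]
      field_simp
      rw [hrsq]
      linear_combination hy1
    · simp only [invSqCoeff, hdet, Matrix.cons_val, Fin.mk_one]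
      rw [e0, e1, e2]
      field_simp
      rw [hrsq]
      ring
    · simp only [invSqCoeff, hdet, Matrix.cons_val, Fin.reduceFinMk]
      rw [e0, e1]
      field_simp
      rw [hrsq]
      linear_combination hy1

/-- The functional calculus gives a left inverse of `A ↦ A⁻²` and the closed form gives a right
inverse, so the two agree. -/
theorem invSqrtCoeff_eq_formula {y : Fin 3 → ℝ} (hy : (symMat y).PosDef) :
    invSqrtCoeff y = invSqrtFormula y := by
  obtain ⟨h1, h2⟩ := invSqrtFormula_spec hy
  conv_lhs => rw [← h2]
  exact invSqrtCoeff_invSqCoeff h1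

theorem symMat_invSqrtCoeff_posDef {y : Fin 3 → ℝ} (hy : (symMat y).PosDef) :
    (symMat (invSqrtCoeff y)).PosDef := by
  rw [invSqrtCoeff_eq_formula hy]
  exact (invSqrtFormula_spec hy).1

theorem invSqCoeff_invSqrtCoeff {y : Fin 3 → ℝ} (hy : (symMat y).PosDef) :
    invSqCoeff (invSqrtCoeff y) = y := by
  rw [invSqrtCoeff_eq_formula hy]
  exact (invSqrtFormula_spec hy).2

theorem invSqrtCoeff_mul_self_mul {y : Fin 3 → ℝ} (hy : (symMat y).PosDef) :
    symMat (invSqrtCoeff y) * symMat (invSqrtCoeff y) * symMat y = 1 := by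
  have h := ((symMat_posDef_iff _).1 (symMat_invSqrtCoeff_posDef hy)).2
  have := symMat_mul_self_mul_invSqCoeff h.ne'
  rwa [invSqCoeff_invSqrtCoeff hy] at this

theorem isOpen_symMat_posDef : IsOpen {y : Fin 3 → ℝ | (symMat y).PosDef} := by
  simp only [symMat_posDef_iff]
  have h (l : Fin 3) : Continuous fun y : Fin 3 → ℝ => y l := continuous_apply l
  exact (isOpen_lt continuous_const (h 0)).inter
    (isOpen_lt continuous_const (((h 0).mul (h 2)).sub ((h 1).pow 2)))

/-- Smoothness is read off the closed form: both radicands are positive on the open cone. -/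
theorem contDiffAt_invSqrtCoeff {n : WithTop ℕ∞} {y : Fin 3 → ℝ} (hy : (symMat y).PosDef) :
    ContDiffAt ℝ n invSqrtCoeff y := by
  have he : invSqrtCoeff =ᶠ[nhds y] invSqrtFormula := by
    filter_upwards [isOpen_symMat_posDef.mem_nhds hy] with z hz
    exact invSqrtCoeff_eq_formula hz
  refine ContDiffAt.congr_of_eventuallyEq ?_ he
  obtain ⟨h0, h⟩ := (symMat_posDef_iff y).1 hy
  have h2 : 0 < y 2 := hy.diag_pos (i := 1)
  have hc : ∀ l : Fin 3, ContDiffAt ℝ n (fun z : Fin 3 → ℝ => z l) y :=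
    fun l => contDiffAt_pi.1 contDiffAt_id l
  have hd : ContDiffAt ℝ n (fun z : Fin 3 → ℝ => Real.sqrt (z 0 * z 2 - z 1 ^ 2)) y :=
    (((hc 0).mul (hc 2)).sub ((hc 1).pow 2)).sqrt h.ne'
  have hr : ContDiffAt ℝ n
      (fun z : Fin 3 → ℝ => Real.sqrt (z 0 + z 2 + 2 * Real.sqrt (z 0 * z 2 - z 1 ^ 2))) y :=
    (((hc 0).add (hc 2)).add (contDiffAt_const.mul hd)).sqrt
      (by have := Real.sqrt_nonneg (y 0 * y 2 - y 1 ^ 2); positivity)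
  have hdr := hd.mul hr
  have hne : Real.sqrt (y 0 * y 2 - y 1 ^ 2)
      * Real.sqrt (y 0 + y 2 + 2 * Real.sqrt (y 0 * y 2 - y 1 ^ 2)) ≠ 0 := by
    have := Real.sqrt_pos.2 h
    exact (mul_pos this (Real.sqrt_pos.2 (by positivity))).ne'
  rw [contDiffAt_pi]
  intro l
  fin_cases l
  · exact ((hc 2).add hd).div hdr hne
  · exact (hc 1).neg.div hdr hne
  · exact ((hc 0).add hd).div hdr hne

theorem contDiffAt_invSqCoeff {n : WithTop ℕ∞} {a : Fin 3 → ℝ} (ha : (symMat a).PosDef) :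
    ContDiffAt ℝ n invSqCoeff a := by
  have h := ((symMat_posDef_iff a).1 ha).2
  have hc : ∀ l : Fin 3, ContDiffAt ℝ n (fun z : Fin 3 → ℝ => z l) a :=
    fun l => contDiffAt_pi.1 contDiffAt_id l
  have hd := (((hc 0).mul (hc 2)).sub ((hc 1).pow 2)).pow 2
  have hne : (a 0 * a 2 - a 1 ^ 2) ^ 2 ≠ 0 := by positivity
  rw [contDiffAt_pi]
  intro l
  fin_cases l
  · exact (((hc 1).pow 2).add ((hc 2).pow 2)).div hd hne
  · exact ((hc 1).mul ((hc 0).add (hc 2))).neg.div hd hne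
  · exact (((hc 0).pow 2).add ((hc 1).pow 2)).div hd hne

/-! ### The derivative of the inverse square root -/

theorem symMat_add (x y : Fin 3 → ℝ) : symMat (x + y) = symMat x + symMat y := by
  ext i j
  fin_cases i <;> fin_cases j <;> simp [symMat]

theorem symMat_smul (c : ℝ) (y : Fin 3 → ℝ) : symMat (c • y) = c • symMat y := by
  ext i j
  fin_cases i <;> fin_cases j <;> simp [symMat]

theorem symMat_injective : Function.Injective symMat :=
  Function.LeftInverse.injective symEntries_symMat

theorem symMat_symEntries {S : Matrix (Fin 2) (Fin 2) ℝ} (hS : Sᵀ = S) :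
    symMat (symEntries S) = S := by
  have h : S 1 0 = S 0 1 := congrFun (congrFun hS 0) 1
  ext i j
  fin_cases i <;> fin_cases j <;> simp [symMat, symEntries, h]

theorem symMat_transpose (y : Fin 3 → ℝ) : (symMat y)ᵀ = symMat y := by
  ext i j
  fin_cases i <;> fin_cases j <;> simp [symMat]

/-- The Lyapunov operator of a positive definite matrix is injective. -/
theorem eq_zero_of_lyapunov {a x : Fin 3 → ℝ} (ha : (symMat a).PosDef)
    (h : symMat x * symMat a + symMat a * symMat x = 0) : x = 0 := by
  obtain ⟨h0, hd⟩ := (symMat_posDef_iff a).1 ha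
  have h2 : 0 < a 2 := ha.diag_pos (i := 1)
  have e00 := congrFun (congrFun h 0) 0
  have e01 := congrFun (congrFun h 0) 1
  have e11 := congrFun (congrFun h 1) 1
  simp [symMat] at e00 e01 e11
  -- Since `tr (adj A (X A + A X)) = 2 det A tr X`, the entries of the adjugate are the coefficients
  -- that isolate the trace of `X`.
  have hs : x 0 + x 2 = 0 := by
    have : (a 0 * a 2 - a 1 ^ 2) * (x 0 + x 2) = 0 := by
      linear_combination (a 2 / 2) * e00 + (a 0 / 2) * e11 - a 1 * e01
    exact (mul_eq_zero.1 this).resolve_left hd.ne'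
  have h1 : x 1 = 0 := by
    have : (a 0 + a 2) * x 1 = 0 := by linear_combination e01 - a 1 * hs
    exact (mul_eq_zero.1 this).resolve_left (by positivity)
  have hx0 : x 0 = 0 := by
    have : a 0 * x 0 = 0 := by linear_combination e00 / 2 - a 1 * h1
    exact (mul_eq_zero.1 this).resolve_left h0.ne'
  have hx2 : x 2 = 0 := by linarith
  ext l
  fin_cases l <;> assumption

section

attribute [local instance] Matrix.linftyOpNormedRing Matrix.linftyOpNormedAlgebra

theorem HasDerivAt.symMat {a : ℝ → Fin 3 → ℝ} {a' : Fin 3 → ℝ} {t : ℝ} (h : HasDerivAt a a' t) :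
    HasDerivAt (fun s => _root_.symMat (a s)) (_root_.symMat a') t := by
  let L : (Fin 3 → ℝ) →ₗ[ℝ] Matrix (Fin 2) (Fin 2) ℝ :=
    { toFun := _root_.symMat, map_add' := symMat_add, map_smul' := symMat_smul }
  exact (LinearMap.toContinuousLinearMap L).hasFDerivAt.comp_hasDerivAt t h

/-- The differential of `Y ↦ Y^(-1/2)` solves a Lyapunov equation. -/
theorem fderiv_invSqrtCoeff_spec {y : Fin 3 → ℝ} (hy : (symMat y).PosDef) (z : Fin 3 → ℝ) :
    (symMat (fderiv ℝ invSqrtCoeff y z) * symMat (invSqrtCoeff y)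
      + symMat (invSqrtCoeff y) * symMat (fderiv ℝ invSqrtCoeff y z)) * symMat y
      + symMat (invSqrtCoeff y) * symMat (invSqrtCoeff y) * symMat z = 0 := by
  have hl : HasDerivAt (fun t : ℝ => y + t • z) z 0 := by
    simpa using ((hasDerivAt_id (0 : ℝ)).smul_const z).const_add y
  have hl0 : y + (0 : ℝ) • z = y := by simp
  have hF : HasFDerivAt invSqrtCoeff (fderiv ℝ invSqrtCoeff y) (y + (0 : ℝ) • z) := by
    rw [hl0]
    exact ((contDiffAt_invSqrtCoeff (n := 1) hy).differentiableAt one_ne_zero).hasFDerivAt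
  have hA := (hF.comp_hasDerivAt (0 : ℝ) hl).symMat
  have hP := (hA.mul hA).mul hl.symMat
  -- The product `A A Y` is constantly `1` near `0`, so the derivative `hP` obtained from the
  -- product rule vanishes.
  have hc : HasDerivAt (fun _ : ℝ => (1 : Matrix (Fin 2) (Fin 2) ℝ)) 0 0 := hasDerivAt_const _ _
  have he : (fun _ : ℝ => (1 : Matrix (Fin 2) (Fin 2) ℝ)) =ᶠ[nhds 0] fun t =>
      symMat (invSqrtCoeff (y + t • z)) * symMat (invSqrtCoeff (y + t • z))
        * symMat (y + t • z) := by
    have : ∀ᶠ t in nhds (0 : ℝ), (symMat (y + t • z)).PosDef :=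
      hl.continuousAt.eventually (isOpen_symMat_posDef.mem_nhds (by simpa using hy))
    filter_upwards [this] with t ht
    exact (invSqrtCoeff_mul_self_mul ht).symm
  have := hP.unique (hc.congr_of_eventuallyEq he.symm)
  simpa [hl0] using this

end

/-- Along a curve of positive definite matrices `Y`, the matrix `A = Y^(-1/2)` relaxes linearly
towards `P` if and only if `Y` solves the transformed equation. -/
theorem fderiv_invSqrtCoeff_eq_iff {y : Fin 3 → ℝ} (hy : (symMat y).PosDef) (z : Fin 3 → ℝ)
    {P : Matrix (Fin 2) (Fin 2) ℝ} (hP : Pᵀ = P) (c : ℝ) :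
    fderiv ℝ invSqrtCoeff y z = symEntries (c • (P - symMat (invSqrtCoeff y))) ↔
      z = symEntries (-c • (symMat y * (P * symMat (invSqrtCoeff y)
        + symMat (invSqrtCoeff y) * P - (2 : ℝ) • (symMat y)⁻¹) * symMat y)) := by
  have hX := fderiv_invSqrtCoeff_spec hy z
  have hAY := invSqrtCoeff_mul_self_mul hy
  have hApd := symMat_invSqrtCoeff_posDef hy
  have hAt := symMat_transpose (invSqrtCoeff y)
  have hYt := symMat_transpose y
  generalize fderiv ℝ invSqrtCoeff y z = x at *
  generalize invSqrtCoeff y = a at *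
  have hYA : symMat y * (symMat a * symMat a) = 1 := mul_eq_one_comm.1 hAY
  have hinv : (symMat y)⁻¹ = symMat a * symMat a := Matrix.inv_eq_right_inv hYA
  rw [hinv, ← symMat_injective.eq_iff, ← symMat_injective.eq_iff (a := z),
    symMat_symEntries (by simp [hP, hAt]),
    symMat_symEntries (by
      simp only [Matrix.transpose_smul, Matrix.transpose_mul, Matrix.transpose_sub,
        Matrix.transpose_add, hP, hAt, hYt, Matrix.mul_assoc]
      rw [add_comm (symMat a * P)])]
  set A := symMat a
  set Y := symMat y
  set X := symMat x with hXdef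
  set Z := symMat z
  -- Multiplication by `Y = A⁻²` on the left solves the differentiated identity for `Z`.
  have hZ : Z = -(Y * (X * A + A * X) * Y) := by
    have : Y * ((X * A + A * X) * Y + A * A * Z) = 0 := by rw [hX, mul_zero]
    rw [mul_add, ← mul_assoc, ← mul_assoc, hYA, one_mul] at this
    exact (neg_eq_of_add_eq_zero_right this).symm
  constructor
  · intro h
    rw [hZ, h]
    simp only [smul_mul_assoc, mul_smul_comm, mul_sub, sub_mul, mul_add, add_mul, mul_assoc,
      neg_smul, smul_sub, smul_add]
    module
  · intro h
    have h1 : X * A + A * X = c • (P * A + A * P - (2 : ℝ) • (A * A)) := by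
      have e : Y * (X * A + A * X) * Y
          = Y * (c • (P * A + A * P - (2 : ℝ) • (A * A))) * Y := by
        rw [← neg_inj, ← hZ, h]
        simp only [smul_mul_assoc, mul_smul_comm, neg_smul]
      have e2 : A * A * (Y * (X * A + A * X) * Y) * (A * A)
          = A * A * (Y * (c • (P * A + A * P - (2 : ℝ) • (A * A))) * Y) * (A * A) := by rw [e]
      -- Multiplying by `A A = Y⁻¹` on both sides cancels the two factors `Y`.
      have red : ∀ M : Matrix (Fin 2) (Fin 2) ℝ, A * A * (Y * M * Y) * (A * A) = M := by
        intro M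
        calc A * A * (Y * M * Y) * (A * A) = (A * A * Y) * M * (Y * (A * A)) := by
              simp only [mul_assoc]
          _ = M := by rw [hAY, hYA, one_mul, mul_one]
      rwa [red, red] at e2
    have hs : (c • (P - A))ᵀ = c • (P - A) := by simp [hP, hAt]
    have h2 : symMat (x - symEntries (c • (P - A))) = X - c • (P - A) := by
      rw [sub_eq_add_neg, ← neg_one_smul ℝ (symEntries _), symMat_add, symMat_smul,
        symMat_symEntries hs, neg_one_smul, ← sub_eq_add_neg]
    -- Both `X` and `c (P - A)` solve the same Lyapunov equation, so injectivity identifies them.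
    have h3 : x - symEntries (c • (P - A)) = 0 := by
      apply eq_zero_of_lyapunov hApd
      rw [h2]
      calc (X - c • (P - A)) * A + A * (X - c • (P - A))
          = (X * A + A * X) - c • (P * A + A * P - (2 : ℝ) • (A * A)) := by
            simp only [mul_sub, sub_mul, smul_mul_assoc, mul_smul_comm, smul_sub, smul_add]
            module
        _ = 0 := by rw [h1, sub_self]
    rw [hXdef, sub_eq_zero.1 h3, symMat_symEntries hs]

/-! ### The state domain and the change of variables -/

/-- Division by `H > 0` does not affect positivity. In the conserved variables the domain is
therefore a product of open convex sets, whence openness and convexity. -/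
theorem mem_AHPlus_iff (q : SvmState) :
    q ∈ AHPlus ↔ 0 < q.1 ∧ (symMat q.2.2.2.1).PosDef ∧ 0 < q.2.2.2.2 := by
  change 0 < q.1 ∧ (symMat (fun l => q.2.2.2.1 l / q.1)).PosDef ∧ 0 < q.2.2.2.2 / q.1 ↔ _
  refine and_congr_right fun h => and_congr ?_ ?_
  · simp only [div_eq_inv_mul]
    exact symMat_posDef_smul_iff (inv_pos.2 h) _
  · exact div_pos_iff_of_pos_right h

theorem isOpen_AHPlus : IsOpen AHPlus := by
  have : AHPlus = {q : SvmState | 0 < q.1} ∩ ((fun q : SvmState => q.2.2.2.1) ⁻¹'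
      {y | (symMat y).PosDef} ∩ {q : SvmState | 0 < q.2.2.2.2}) := by
    ext q
    exact mem_AHPlus_iff q
  rw [this]
  exact (isOpen_lt continuous_const (by fun_prop)).inter
    ((isOpen_symMat_posDef.preimage (by fun_prop)).inter
      (isOpen_lt continuous_const (by fun_prop)))

theorem convex_AHPlus : Convex ℝ AHPlus := by
  rw [convex_iff_forall_pos]
  intro q hq r hr a b ha hb hab
  rw [mem_AHPlus_iff] at *
  refine ⟨?_, convex_iff_forall_pos.1 symMat_posDef_convex hq.2.1 hr.2.1 ha hb hab, ?_⟩
  · change 0 < a * q.1 + b * r.1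
    have := hq.1
    have := hr.1
    positivity
  · change 0 < a * q.2.2.2.2 + b * r.2.2.2.2
    have := hq.2.2
    have := hr.2.2
    positivity

/-- The conserved variables `(H, HU, HF, HY, HYcc)` as a function of `(H, U, F, A, Acc)`. -/
def consOfPrim (p : SvmState) : SvmState :=
  (p.depth, fun i => p.depth * p.vec i, fun i α => p.depth * p.mat i α,
    fun l => p.depth * invSqCoeff p.symCoeff l, p.depth * Real.sqrt (Real.sqrt p.scal))

theorem primY_consOfPrim {p : SvmState} (hp : 0 < p.depth) :
    primY (consOfPrim p)
      = (p.depth, p.vec, p.2.2.1, invSqCoeff p.symCoeff, Real.sqrt (Real.sqrt p.scal)) := by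
  have h := hp.ne'
  refine Prod.ext rfl (Prod.ext ?_ (Prod.ext ?_ (Prod.ext ?_ ?_)))
  · funext i
    exact mul_div_cancel_left₀ _ h
  · funext i j
    exact mul_div_cancel_left₀ _ h
  · funext l
    exact mul_div_cancel_left₀ _ h
  · exact mul_div_cancel_left₀ _ h

theorem consOfPrim_mem {p : SvmState} (hp : p ∈ SvmAdmissible) : consOfPrim p ∈ AHPlus := by
  obtain ⟨h0, h1, h2⟩ := hp
  refine ⟨h0, ?_, ?_⟩
  · rw [primY_consOfPrim h0]
    exact symMat_invSqCoeff_posDef h1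
  · rw [primY_consOfPrim h0]
    exact Real.sqrt_pos.2 (Real.sqrt_pos.2 h2)

theorem primA_consOfPrim {p : SvmState} (hp : p ∈ SvmAdmissible) : primA (consOfPrim p) = p := by
  obtain ⟨h0, h1, h2⟩ := hp
  have e : primA (consOfPrim p) = (p.depth, (primY (consOfPrim p)).vec,
    (primY (consOfPrim p)).2.2.1, invSqrtCoeff (primY (consOfPrim p)).symCoeff,
    (primY (consOfPrim p)).scal ^ 4) := rfl
  rw [e, primY_consOfPrim h0]
  refine Prod.ext rfl (Prod.ext rfl (Prod.ext rfl (Prod.ext ?_ ?_)))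
  · exact invSqrtCoeff_invSqCoeff h1
  · change Real.sqrt (Real.sqrt p.scal) ^ 4 = p.scal
    rw [show (4 : ℕ) = 2 * 2 from rfl, pow_mul, Real.sq_sqrt (Real.sqrt_nonneg _),
      Real.sq_sqrt h2.le]

theorem primA_mem {q : SvmState} (hq : q ∈ AHPlus) : primA q ∈ SvmAdmissible :=
  ⟨hq.1, symMat_invSqrtCoeff_posDef hq.2.1, pow_pos hq.2.2 4⟩

theorem consOfPrim_primA {q : SvmState} (hq : q ∈ AHPlus) : consOfPrim (primA q) = q := by
  have h : q.depth ≠ 0 := hq.1.ne'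
  refine Prod.ext rfl (Prod.ext ?_ (Prod.ext ?_ (Prod.ext ?_ ?_)))
  · funext i
    exact mul_div_cancel₀ _ h
  · funext i j
    exact mul_div_cancel₀ _ h
  · have e : invSqCoeff (primA q).symCoeff = (primY q).symCoeff := invSqCoeff_invSqrtCoeff hq.2.1
    funext l
    change q.depth * invSqCoeff (primA q).symCoeff l = _
    rw [e]
    exact mul_div_cancel₀ _ h
  · change q.depth * Real.sqrt (Real.sqrt ((primY q).scal ^ 4)) = _
    have hs := hq.2.2.le
    rw [show (4 : ℕ) = 2 * 2 from rfl, pow_mul, Real.sqrt_sq (by positivity), Real.sqrt_sq hs]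
    exact mul_div_cancel₀ _ h

theorem bijOn_primA : Set.BijOn primA AHPlus SvmAdmissible :=
  Set.InvOn.bijOn ⟨fun _ hq => consOfPrim_primA hq, fun _ hp => primA_consOfPrim hp⟩
    (fun _ hq => primA_mem hq) (fun _ hp => consOfPrim_mem hp)

theorem contDiffAt_primY {n : WithTop ℕ∞} {q : SvmState} (hq : q ∈ AHPlus) :
    ContDiffAt ℝ n primY q := by
  have h : q.1 ≠ 0 := hq.1.ne'
  unfold primY SvmState.depth SvmState.vec SvmState.mat SvmState.symCoeff SvmState.scal
  simp only [Matrix.of_apply]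
  fun_prop (disch := exact h)

theorem contDiffAt_invSqrtCoeff_primY {n : WithTop ℕ∞} {q : SvmState} (hq : q ∈ AHPlus) :
    ContDiffAt ℝ n (fun r => invSqrtCoeff (primY r).symCoeff) q := by
  have h := contDiffAt_primY (n := n) hq
  have h2 : ContDiffAt ℝ n (fun r => (primY r).symCoeff) q := h.snd.snd.snd.fst
  exact ContDiffAt.comp (g := invSqrtCoeff) q (contDiffAt_invSqrtCoeff hq.2.1) h2

theorem contDiffAt_primA {n : WithTop ℕ∞} {q : SvmState} (hq : q ∈ AHPlus) :
    ContDiffAt ℝ n primA q := by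
  have h := contDiffAt_primY (n := n) hq
  exact contDiffAt_fst.prodMk (h.snd.fst.prodMk (h.snd.snd.fst.prodMk
    ((contDiffAt_invSqrtCoeff_primY hq).prodMk (h.snd.snd.snd.snd.pow 4))))

theorem contDiffAt_consOfPrim {n : WithTop ℕ∞} {p : SvmState} (hp : p ∈ SvmAdmissible) :
    ContDiffAt ℝ n consOfPrim p := by
  have h4 : ContDiffAt ℝ n (fun r : SvmState => invSqCoeff r.2.2.2.1) p := by
    have h2 : ContDiffAt ℝ n (fun r : SvmState => r.2.2.2.1) p := by fun_prop
    exact (contDiffAt_invSqCoeff hp.2.1).comp p h2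
  have h5 : ContDiffAt ℝ n (fun r : SvmState => Real.sqrt (Real.sqrt r.2.2.2.2)) p := by
    have h2 : ContDiffAt ℝ n (fun r : SvmState => r.2.2.2.2) p := by fun_prop
    exact (h2.sqrt hp.2.2.ne').sqrt (Real.sqrt_pos.2 hp.2.2).ne'
  have h0 : ContDiffAt ℝ n (fun r : SvmState => r.1) p := by fun_prop
  unfold consOfPrim SvmState.depth SvmState.vec SvmState.mat SvmState.symCoeff SvmState.scal
  refine h0.prodMk (ContDiffAt.prodMk ?_ (ContDiffAt.prodMk ?_
    (ContDiffAt.prodMk ?_ (h0.mul h5))))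
  · fun_prop
  · simp only [Matrix.of_apply]
    fun_prop
  · exact contDiffAt_pi.2 fun l => h0.mul (contDiffAt_pi.1 h4 l)

/-! ### Derivatives of the functional and of the fluxes -/

/-- The coefficients of `A = Y^(-1/2)` as a function of `q`. -/
def stretchCoeff (q : SvmState) : Fin 3 → ℝ := invSqrtCoeff (primY q).symCoeff

/-- The entries of `W A Wᵀ`. -/
def congrEntry (W : Fin 2 → Fin 2 → ℝ) (a : Fin 3 → ℝ) (i j : Fin 2) : ℝ :=
  W i 0 * (a 0 * W j 0 + a 1 * W j 1) + W i 1 * (a 1 * W j 0 + a 2 * W j 1)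

/-- The derivative of the entries of `W A Wᵀ`. -/
def congrEntryDeriv (W V : Fin 2 → Fin 2 → ℝ) (a b : Fin 3 → ℝ) (i j : Fin 2) : ℝ :=
  V i 0 * (a 0 * W j 0 + a 1 * W j 1) + V i 1 * (a 1 * W j 0 + a 2 * W j 1)
    + (W i 0 * (b 0 * W j 0 + b 1 * W j 1) + W i 1 * (b 1 * W j 0 + b 2 * W j 1))
    + (W i 0 * (a 0 * V j 0 + a 1 * V j 1) + W i 1 * (a 1 * V j 0 + a 2 * V j 1))

/-- The functional in terms of the conserved variables and of the coefficients of `A`. -/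
def energyFormula (g G : ℝ) (q : SvmState) (a : Fin 3 → ℝ) : ℝ :=
  g / 2 * q.1 ^ 2 + (q.2.1 0 ^ 2 + q.2.1 1 ^ 2
    + G * (congrEntry q.2.2.1 a 0 0 + congrEntry q.2.2.1 a 1 1) + G * q.2.2.2.2 ^ 4
    + (q.2.2.2.1 0 ^ 2 + 2 * q.2.2.2.1 1 ^ 2 + q.2.2.2.1 2 ^ 2)) / (2 * q.1)

/-- The derivative of `energyFormula` at `(q, a)` in the direction `(v, b)`. -/
def energyDeriv (g G : ℝ) (q v : SvmState) (a b : Fin 3 → ℝ) : ℝ :=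
  g * q.1 * v.1 + (2 * q.2.1 0 * v.2.1 0 + 2 * q.2.1 1 * v.2.1 1
    + G * (congrEntryDeriv q.2.2.1 v.2.2.1 a b 0 0 + congrEntryDeriv q.2.2.1 v.2.2.1 a b 1 1)
    + 4 * G * q.2.2.2.2 ^ 3 * v.2.2.2.2
    + (2 * q.2.2.2.1 0 * v.2.2.2.1 0 + 4 * q.2.2.2.1 1 * v.2.2.2.1 1
      + 2 * q.2.2.2.1 2 * v.2.2.2.1 2)) / (2 * q.1)
  - (q.2.1 0 ^ 2 + q.2.1 1 ^ 2
    + G * (congrEntry q.2.2.1 a 0 0 + congrEntry q.2.2.1 a 1 1) + G * q.2.2.2.2 ^ 4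
    + (q.2.2.2.1 0 ^ 2 + 2 * q.2.2.2.1 1 ^ 2 + q.2.2.2.1 2 ^ 2)) * v.1 / (2 * q.1 ^ 2)

/-- The derivative of the `j`-th flux in the direction `v`, if `A` varies in the direction `b`. -/
def fluxDeriv (g G : ℝ) (j : Fin 2) (q v : SvmState) (a b : Fin 3 → ℝ) : SvmState :=
  (v.2.1 j,
    fun i => (v.2.1 i * q.2.1 j + q.2.1 i * v.2.1 j) / q.1 - q.2.1 i * q.2.1 j * v.1 / q.1 ^ 2
      + (g * q.1 * v.1 + G * (4 * q.2.2.2.2 ^ 3 * v.2.2.2.2 / q.1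
        - q.2.2.2.2 ^ 4 * v.1 / q.1 ^ 2)) * (1 : Matrix (Fin 2) (Fin 2) ℝ) i j
      - G * (congrEntryDeriv q.2.2.1 v.2.2.1 a b i j / q.1
        - congrEntry q.2.2.1 a i j * v.1 / q.1 ^ 2),
    fun i α => (v.2.1 j * q.2.2.1 i α + q.2.1 j * v.2.2.1 i α
        - (v.2.2.1 j α * q.2.1 i + q.2.2.1 j α * v.2.1 i)) / q.1
      - (q.2.1 j * q.2.2.1 i α - q.2.2.1 j α * q.2.1 i) * v.1 / q.1 ^ 2,
    fun l => (v.2.1 j * q.2.2.2.1 l + q.2.1 j * v.2.2.2.1 l) / q.1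
      - q.2.1 j * q.2.2.2.1 l * v.1 / q.1 ^ 2,
    (v.2.1 j * q.2.2.2.2 + q.2.1 j * v.2.2.2.2) / q.1 - q.2.1 j * q.2.2.2.2 * v.1 / q.1 ^ 2)

/-- The derivative of the `j`-th energy flux in the direction `v`, if `A` varies in the direction
`b`. -/
def energyFluxDeriv (g G : ℝ) (j : Fin 2) (q v : SvmState) (a b : Fin 3 → ℝ) : ℝ :=
  (v.2.1 j / q.1 - q.2.1 j * v.1 / q.1 ^ 2) * (energyFormula g G q a + g / 2 * q.1 ^ 2)
    + q.2.1 j / q.1 * (energyDeriv g G q v a b + g * q.1 * v.1)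
    + G * (4 * q.2.2.2.2 ^ 3 * v.2.2.2.2 * q.2.1 j + q.2.2.2.2 ^ 4 * v.2.1 j) / q.1 ^ 2
    - 2 * G * q.2.2.2.2 ^ 4 * q.2.1 j * v.1 / q.1 ^ 3
    - (G * ∑ k, (congrEntryDeriv q.2.2.1 v.2.2.1 a b j k * q.2.1 k
        + congrEntry q.2.2.1 a j k * v.2.1 k) / q.1 ^ 2
      - 2 * G * (∑ k, congrEntry q.2.2.1 a j k * q.2.1 k) * v.1 / q.1 ^ 3)

theorem mat_mul_sym_mul_transpose (p : SvmState) (i j : Fin 2) :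
    (p.mat * p.sym * p.matᵀ) i j = congrEntry p.2.2.1 p.symCoeff i j := by
  simp only [Matrix.mul_apply, Fin.sum_univ_two, Matrix.transpose_apply, SvmState.mat,
    SvmState.sym, Matrix.of_apply, congrEntry, Matrix.cons_val_zero,
    Matrix.cons_val_one]
  ring

theorem congrEntry_div {c : ℝ} (W : Fin 2 → Fin 2 → ℝ) (a : Fin 3 → ℝ) (i j : Fin 2) :
    congrEntry (fun i α => W i α / c) a i j = congrEntry W a i j / c ^ 2 := by
  simp only [congrEntry]
  ring

theorem mat_mul_sym_primA (q : SvmState) (i j : Fin 2) :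
    ((primA q).mat * (primA q).sym * (primA q).matᵀ) i j
      = congrEntry q.2.2.1 (stretchCoeff q) i j / q.1 ^ 2 := by
  rw [mat_mul_sym_mul_transpose]
  exact congrEntry_div _ _ i j

/-- The powers of `H` combine so that the only denominator is `2H`, and the matrix root enters only
through the coefficients of `A`. This is the form that is differentiated below. -/
theorem svmEnergy_eq (g G : ℝ) {q : SvmState} (hq : q.1 ≠ 0) :
    svmEnergy g G q = energyFormula g G q (stretchCoeff q) := by
  have h1 : (stressH G (primA q)).trace = G * (congrEntry q.2.2.1 (stretchCoeff q) 0 0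
      + congrEntry q.2.2.1 (stretchCoeff q) 1 1) / q.1 ^ 2 := by
    simp only [stressH, Matrix.trace_fin_two, Matrix.smul_apply, mat_mul_sym_primA, smul_eq_mul]
    ring
  have h2 : stressZZ G (primA q) = G * (q.2.2.2.2 / q.1) ^ 4 * q.1 ^ 2 := rfl
  have h3 : ((primY q).sym * (primY q).sym).trace = (q.2.2.2.1 0 / q.1) ^ 2
      + 2 * (q.2.2.2.1 1 / q.1) ^ 2 + (q.2.2.2.1 2 / q.1) ^ 2 := by
    simp only [Matrix.trace_fin_two, Matrix.mul_apply, Fin.sum_univ_two, SvmState.sym,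
      SvmState.symCoeff, primY, Matrix.of_apply, Matrix.cons_val, SvmState.depth]
    ring
  have h4 : ∀ i, (primA q).vec i = q.2.1 i / q.1 := fun _ => rfl
  rw [svmEnergy, h1, h2, h3, Fin.sum_univ_two, h4, h4, energyFormula]
  change q.1 / 2 * (_ + g * q.1 + _) = _
  field_simp
  ring

theorem momentumFlux_primA (g G : ℝ) {q : SvmState} (hq : q.1 ≠ 0) (i j : Fin 2) :
    momentumFlux g G (primA q) i j = q.2.1 i * q.2.1 j / q.1
      + (g / 2 * q.1 ^ 2 + G * (q.2.2.2.2 ^ 4 / q.1)) * (1 : Matrix (Fin 2) (Fin 2) ℝ) i j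
      - G * (congrEntry q.2.2.1 (stretchCoeff q) i j / q.1) := by
  simp only [momentumFlux, Matrix.sub_apply, Matrix.add_apply, Matrix.smul_apply,
    mat_mul_sym_primA, smul_eq_mul, Matrix.vecMulVec_apply]
  change q.1 * (q.2.1 i / q.1 * (q.2.1 j / q.1))
    + (g / 2 * q.1 ^ 2 + G * (q.2.2.2.2 / q.1) ^ 4 * q.1 ^ 3) * _ - G * q.1 * _ = _
  field_simp

theorem svmEnergyFlux_eq (g G : ℝ) (j : Fin 2) {q : SvmState} (hq : q.1 ≠ 0) :
    svmEnergyFlux g G j q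
      = q.2.1 j / q.1 * (energyFormula g G q (stretchCoeff q) + g / 2 * q.1 ^ 2)
        + G * (q.2.2.2.2 ^ 4 * q.2.1 j) / q.1 ^ 2
        - G * (∑ k, congrEntry q.2.2.1 (stretchCoeff q) j k * q.2.1 k) / q.1 ^ 2 := by
  have h : ((stressZZ G (primA q) • (1 : Matrix (Fin 2) (Fin 2) ℝ)
        - stressH G (primA q)) *ᵥ (primA q).vec) j
      = G * (q.2.2.2.2 / q.1) ^ 4 * q.1 ^ 2 * (q.2.1 j / q.1)
        - ∑ k, G * (congrEntry q.2.2.1 (stretchCoeff q) j k / q.1 ^ 2) * (q.2.1 k / q.1) := by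
    rw [Matrix.sub_mulVec, Matrix.smul_mulVec, Matrix.one_mulVec]
    simp only [Pi.sub_apply, Pi.smul_apply, smul_eq_mul, Matrix.mulVec, dotProduct, stressH,
      Matrix.smul_apply, mat_mul_sym_primA]
    rfl
  rw [svmEnergyFlux, h, svmEnergy_eq g G hq]
  simp only [Fin.sum_univ_two]
  change q.2.1 j / q.1 * (_ + g / 2 * q.1 ^ 2) + q.1 * _ = _
  field_simp
  ring

theorem svm1Flux_eq (g G : ℝ) (j : Fin 2) {q : SvmState} (hq : q.1 ≠ 0) :
    svm1Flux g G j q = (q.2.1 j,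
      fun i => q.2.1 i * q.2.1 j / q.1
        + (g / 2 * q.1 ^ 2 + G * (q.2.2.2.2 ^ 4 / q.1)) * (1 : Matrix (Fin 2) (Fin 2) ℝ) i j
        - G * (congrEntry q.2.2.1 (stretchCoeff q) i j / q.1),
      fun i α => (q.2.1 j * q.2.2.1 i α - q.2.2.1 j α * q.2.1 i) / q.1,
      fun l => q.2.1 j * q.2.2.2.1 l / q.1, q.2.1 j * q.2.2.2.2 / q.1) := by
  refine Prod.ext rfl (Prod.ext ?_ (Prod.ext ?_ (Prod.ext ?_ ?_)))
  · funext i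
    exact momentumFlux_primA g G hq i j
  · funext i α
    change q.2.1 j / q.1 * q.2.2.1 i α - q.2.2.1 j α * (q.2.1 i / q.1) = _
    ring
  · funext l
    change q.2.1 j / q.1 * q.2.2.2.1 l = _
    ring
  · change q.2.1 j / q.1 * q.2.2.2.2 = _
    ring

/-! ### Smoothness of the functional and of the fluxes -/

theorem contDiffAt_stretchCoeff {n : WithTop ℕ∞} {q : SvmState} (hq : q ∈ AHPlus) :
    ContDiffAt ℝ n stretchCoeff q := contDiffAt_invSqrtCoeff_primY hq

theorem eventually_mem_AHPlus {q : SvmState} (hq : q ∈ AHPlus) : ∀ᶠ r in nhds q, r ∈ AHPlus :=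
  isOpen_AHPlus.mem_nhds hq

theorem contDiffAt_congrEntry {n : WithTop ℕ∞} {q : SvmState} (hq : q ∈ AHPlus) (i j : Fin 2) :
    ContDiffAt ℝ n (fun r : SvmState => congrEntry r.2.2.1 (stretchCoeff r) i j) q := by
  have h := contDiffAt_pi.1 (contDiffAt_stretchCoeff (n := n) hq)
  have h0 := h 0
  have h1 := h 1
  have h2 := h 2
  unfold congrEntry
  fun_prop

theorem contDiffAt_svmEnergy {n : WithTop ℕ∞} (g G : ℝ) {q : SvmState} (hq : q ∈ AHPlus) :
    ContDiffAt ℝ n (svmEnergy g G) q := by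
  have h0 : q.1 ≠ 0 := hq.1.ne'
  have he : svmEnergy g G =ᶠ[nhds q] fun r => energyFormula g G r (stretchCoeff r) := by
    filter_upwards [eventually_mem_AHPlus hq] with r hr
    exact svmEnergy_eq g G hr.1.ne'
  refine ContDiffAt.congr_of_eventuallyEq ?_ he
  have h1 := contDiffAt_congrEntry (n := n) hq 0 0
  have h2 := contDiffAt_congrEntry (n := n) hq 1 1
  unfold energyFormula
  fun_prop (disch := simpa using h0)

theorem contDiffAt_svm1Flux {n : WithTop ℕ∞} (g G : ℝ) (j : Fin 2) {q : SvmState}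
    (hq : q ∈ AHPlus) : ContDiffAt ℝ n (svm1Flux g G j) q := by
  have h0 : q.1 ≠ 0 := hq.1.ne'
  refine ContDiffAt.congr_of_eventuallyEq ?_ (f := fun q : SvmState => (q.2.1 j,
      fun i => q.2.1 i * q.2.1 j / q.1
        + (g / 2 * q.1 ^ 2 + G * (q.2.2.2.2 ^ 4 / q.1)) * (1 : Matrix (Fin 2) (Fin 2) ℝ) i j
        - G * (congrEntry q.2.2.1 (stretchCoeff q) i j / q.1),
      fun i α => (q.2.1 j * q.2.2.1 i α - q.2.2.1 j α * q.2.1 i) / q.1,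
      fun l => q.2.1 j * q.2.2.2.1 l / q.1, q.2.1 j * q.2.2.2.2 / q.1))
      (by
        filter_upwards [eventually_mem_AHPlus hq] with r hr
        exact svm1Flux_eq g G j hr.1.ne')
  refine ContDiffAt.prodMk ?_ (ContDiffAt.prodMk ?_ (ContDiffAt.prodMk ?_
    (ContDiffAt.prodMk ?_ ?_)))
  · fun_prop
  · refine contDiffAt_pi.2 fun i => ?_
    have h1 := contDiffAt_congrEntry (n := n) hq i j
    fun_prop (disch := exact h0)
  · fun_prop (disch := exact h0)
  · fun_prop (disch := exact h0)
  · fun_prop (disch := exact h0)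

theorem contDiffAt_svmEnergyFlux {n : WithTop ℕ∞} (g G : ℝ) (j : Fin 2) {q : SvmState}
    (hq : q ∈ AHPlus) : ContDiffAt ℝ n (svmEnergyFlux g G j) q := by
  have h0 : q.1 ≠ 0 := hq.1.ne'
  have h1 := contDiffAt_congrEntry (n := n) hq j 0
  have h2 := contDiffAt_congrEntry (n := n) hq j 1
  have h3 := contDiffAt_svmEnergy (n := n) g G hq
  refine ContDiffAt.congr_of_eventuallyEq (f := fun q : SvmState =>
    q.2.1 j / q.1 * (svmEnergy g G q + g / 2 * q.1 ^ 2)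
        + G * (q.2.2.2.2 ^ 4 * q.2.1 j) / q.1 ^ 2
        - G * (congrEntry q.2.2.1 (stretchCoeff q) j 0 * q.2.1 0
          + congrEntry q.2.2.1 (stretchCoeff q) j 1 * q.2.1 1) / q.1 ^ 2) ?_ ?_
  · fun_prop (disch := simpa using h0)
  · filter_upwards [eventually_mem_AHPlus hq] with r hr
    rw [svmEnergyFlux_eq g G j hr.1.ne', svmEnergy_eq g G hr.1.ne', Fin.sum_univ_two]

/-! ### Directional derivatives -/

theorem hasDerivAt_line {E : Type*} [NormedAddCommGroup E] [NormedSpace ℝ E] (q v : E) (t : ℝ) :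
    HasDerivAt (fun s : ℝ => q + s • v) v t := by
  simpa using ((hasDerivAt_id t).smul_const v).const_add q

theorem HasFDerivAt.hasDerivAt_line {E F : Type*} [NormedAddCommGroup E] [NormedSpace ℝ E]
    [NormedAddCommGroup F] [NormedSpace ℝ F] {f : E → F} {f' : E →L[ℝ] F} {q v : E}
    (hf : HasFDerivAt f f' q) : HasDerivAt (fun s : ℝ => f (q + s • v)) (f' v) 0 := by
  have h := _root_.hasDerivAt_line q v 0
  exact HasFDerivAt.comp_hasDerivAt (l := f) (0 : ℝ) (by simpa using hf) h

/-- Differentiability is already known from smoothness, so each directional value of the derivative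
may be computed from a one-variable formula valid near `0`. -/
theorem fderiv_apply_eq_of_line {E F : Type*} [NormedAddCommGroup E] [NormedSpace ℝ E]
    [NormedAddCommGroup F] [NormedSpace ℝ F] {f : E → F} {q v : E} {c : F} {h : ℝ → F}
    (hf : DifferentiableAt ℝ f q) (he : (fun s : ℝ => f (q + s • v)) =ᶠ[nhds 0] h)
    (hd : HasDerivAt h c 0) : fderiv ℝ f q v = c :=
  (hf.hasFDerivAt.hasDerivAt_line (v := v)).unique (hd.congr_of_eventuallyEq he)

theorem eventually_line_mem {q : SvmState} (hq : q ∈ AHPlus) (v : SvmState) :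
    ∀ᶠ s : ℝ in nhds 0, q + s • v ∈ AHPlus :=
  (hasDerivAt_line q v 0).continuousAt.eventually (by simpa using eventually_mem_AHPlus hq)

theorem hasDerivAt_congrEntry {W V : Fin 2 → Fin 2 → ℝ} {a : ℝ → Fin 3 → ℝ} {b : Fin 3 → ℝ}
    (ha : HasDerivAt a b 0) (i j : Fin 2) :
    HasDerivAt (fun s : ℝ => congrEntry (W + s • V) (a s) i j)
      (congrEntryDeriv W V (a 0) b i j) 0 := by
  have hl := hasDerivAt_pi.1 ha
  have hW : ∀ i α, HasDerivAt (fun s : ℝ => (W + s • V) i α) (V i α) 0 := fun i α =>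
    _root_.hasDerivAt_line (W i α) (V i α) 0
  have := ((hW i 0).mul (((hl 0).mul (hW j 0)).add ((hl 1).mul (hW j 1)))).add
    ((hW i 1).mul (((hl 1).mul (hW j 0)).add ((hl 2).mul (hW j 1))))
  refine HasDerivAt.congr_deriv this ?_
  simp [congrEntryDeriv]
  ring

theorem hasDerivAt_stretchCoeff {q : SvmState} (hq : q ∈ AHPlus) (v : SvmState) :
    HasDerivAt (fun s : ℝ => stretchCoeff (q + s • v)) (fderiv ℝ stretchCoeff q v) 0 :=
  ((contDiffAt_stretchCoeff (n := 1) hq).differentiableAt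
    one_ne_zero).hasFDerivAt.hasDerivAt_line

theorem fderiv_stretchCoeff {q : SvmState} (hq : q ∈ AHPlus) (v : SvmState) :
    fderiv ℝ stretchCoeff q v = fderiv ℝ invSqrtCoeff (primY q).symCoeff
      (fun l => (v.2.2.2.1 l - q.2.2.2.1 l / q.1 * v.1) / q.1) := by
  have h0 : q.1 ≠ 0 := hq.1.ne'
  have hH : HasDerivAt (fun s : ℝ => q.1 + s • v.1) v.1 0 := hasDerivAt_line q.1 v.1 0
  have hR : ∀ l, HasDerivAt (fun s : ℝ => q.2.2.2.1 l + s • v.2.2.2.1 l) (v.2.2.2.1 l) 0 :=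
    fun l => hasDerivAt_line _ _ 0
  have hy : HasDerivAt (fun s : ℝ => (primY (q + s • v)).symCoeff)
      (fun l => (v.2.2.2.1 l - q.2.2.2.1 l / q.1 * v.1) / q.1) 0 := by
    rw [hasDerivAt_pi]
    intro l
    refine HasDerivAt.congr_deriv (f := fun s : ℝ => (q.2.2.2.1 l + s • v.2.2.2.1 l)
      / (q.1 + s • v.1)) ((hR l).div hH (by simpa using h0)) ?_
    simp only [zero_smul, add_zero]
    field_simp
  have hF : HasFDerivAt invSqrtCoeff (fderiv ℝ invSqrtCoeff (primY q).symCoeff)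
      (primY (q + (0 : ℝ) • v)).symCoeff := by
    rw [zero_smul, add_zero]
    exact ((contDiffAt_invSqrtCoeff (n := 1) hq.2.1).differentiableAt one_ne_zero).hasFDerivAt
  exact (hasDerivAt_stretchCoeff hq v).unique (hF.comp_hasDerivAt (0 : ℝ) hy)

theorem hasDerivAt_energyFormula (g G : ℝ) {q : SvmState} (hq : q ∈ AHPlus) (v : SvmState) :
    HasDerivAt (fun s : ℝ => energyFormula g G (q + s • v) (stretchCoeff (q + s • v)))
      (energyDeriv g G q v (stretchCoeff q) (fderiv ℝ stretchCoeff q v)) 0 := by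
  have h0 : q.1 ≠ 0 := hq.1.ne'
  have hH : HasDerivAt (fun s : ℝ => q.1 + s • v.1) v.1 0 := hasDerivAt_line q.1 v.1 0
  have hm : ∀ i, HasDerivAt (fun s : ℝ => q.2.1 i + s • v.2.1 i) (v.2.1 i) 0 :=
    fun i => hasDerivAt_line _ _ 0
  have hR : ∀ l, HasDerivAt (fun s : ℝ => q.2.2.2.1 l + s • v.2.2.2.1 l) (v.2.2.2.1 l) 0 :=
    fun l => hasDerivAt_line _ _ 0
  have hs : HasDerivAt (fun s : ℝ => q.2.2.2.2 + s • v.2.2.2.2) v.2.2.2.2 0 :=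
    hasDerivAt_line _ _ 0
  have hT : ∀ i j, HasDerivAt
      (fun s : ℝ => congrEntry (q + s • v).2.2.1 (stretchCoeff (q + s • v)) i j) _ 0 :=
    fun i j => hasDerivAt_congrEntry (hasDerivAt_stretchCoeff hq v) i j
  have hd := ((hH.pow 2).const_mul (g / 2)).add
    ((((((hm 0).pow 2).add ((hm 1).pow 2)).add (((hT 0 0).add (hT 1 1)).const_mul G)).add
      ((hs.pow 4).const_mul G)).add
      ((((hR 0).pow 2).add (((hR 1).pow 2).const_mul 2)).add ((hR 2).pow 2))
      |>.div (hH.const_mul 2) (by simpa using h0))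
  refine HasDerivAt.congr_deriv hd ?_
  simp [energyDeriv]
  field_simp
  ring

theorem fderiv_svmEnergy (g G : ℝ) {q : SvmState} (hq : q ∈ AHPlus) (v : SvmState) :
    fderiv ℝ (svmEnergy g G) q v
      = energyDeriv g G q v (stretchCoeff q) (fderiv ℝ stretchCoeff q v) := by
  refine fderiv_apply_eq_of_line ((contDiffAt_svmEnergy (n := 1) g G hq).differentiableAt
    one_ne_zero) ?_ (hasDerivAt_energyFormula g G hq v)
  filter_upwards [eventually_line_mem hq v] with s hs
  exact svmEnergy_eq g G hs.1.ne'

theorem fderiv_svm1Flux (g G : ℝ) (j : Fin 2) {q : SvmState} (hq : q ∈ AHPlus) (v : SvmState) :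
    fderiv ℝ (svm1Flux g G j) q v
      = fluxDeriv g G j q v (stretchCoeff q) (fderiv ℝ stretchCoeff q v) := by
  have h0 : q.1 ≠ 0 := hq.1.ne'
  have hne : q.1 + (0 : ℝ) • v.1 ≠ 0 := by simpa using h0
  have hH : HasDerivAt (fun s : ℝ => q.1 + s • v.1) v.1 0 := hasDerivAt_line q.1 v.1 0
  have hm : ∀ i, HasDerivAt (fun s : ℝ => q.2.1 i + s • v.2.1 i) (v.2.1 i) 0 :=
    fun i => hasDerivAt_line _ _ 0
  have hW : ∀ i α, HasDerivAt (fun s : ℝ => q.2.2.1 i α + s • v.2.2.1 i α) (v.2.2.1 i α) 0 :=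
    fun i α => hasDerivAt_line _ _ 0
  have hR : ∀ l, HasDerivAt (fun s : ℝ => q.2.2.2.1 l + s • v.2.2.2.1 l) (v.2.2.2.1 l) 0 :=
    fun l => hasDerivAt_line _ _ 0
  have hs : HasDerivAt (fun s : ℝ => q.2.2.2.2 + s • v.2.2.2.2) v.2.2.2.2 0 :=
    hasDerivAt_line _ _ 0
  have hT : ∀ i j, HasDerivAt
      (fun s : ℝ => congrEntry (q + s • v).2.2.1 (stretchCoeff (q + s • v)) i j) _ 0 :=
    fun i j => hasDerivAt_congrEntry (hasDerivAt_stretchCoeff hq v) i j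
  refine fderiv_apply_eq_of_line ((contDiffAt_svm1Flux (n := 1) g G j hq).differentiableAt
    one_ne_zero) (h := fun s : ℝ => (q.2.1 j + s • v.2.1 j,
      fun i => (q.2.1 i + s • v.2.1 i) * (q.2.1 j + s • v.2.1 j) / (q.1 + s • v.1)
        + (g / 2 * (q.1 + s • v.1) ^ 2 + G * ((q.2.2.2.2 + s • v.2.2.2.2) ^ 4 / (q.1 + s • v.1)))
          * (1 : Matrix (Fin 2) (Fin 2) ℝ) i j
        - G * (congrEntry (q + s • v).2.2.1 (stretchCoeff (q + s • v)) i j / (q.1 + s • v.1)),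
      fun i α => ((q.2.1 j + s • v.2.1 j) * (q.2.2.1 i α + s • v.2.2.1 i α)
        - (q.2.2.1 j α + s • v.2.2.1 j α) * (q.2.1 i + s • v.2.1 i)) / (q.1 + s • v.1),
      fun l => (q.2.1 j + s • v.2.1 j) * (q.2.2.2.1 l + s • v.2.2.2.1 l) / (q.1 + s • v.1),
      (q.2.1 j + s • v.2.1 j) * (q.2.2.2.2 + s • v.2.2.2.2) / (q.1 + s • v.1))) ?_ ?_
  · filter_upwards [eventually_line_mem hq v] with s hs
    exact svm1Flux_eq g G j hs.1.ne'
  · refine (hm j).prodMk (HasDerivAt.prodMk (hasDerivAt_pi.2 fun i => ?_)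
      (HasDerivAt.prodMk (hasDerivAt_pi.2 fun i => hasDerivAt_pi.2 fun α => ?_)
      (HasDerivAt.prodMk (hasDerivAt_pi.2 fun l => ?_) ?_)))
    · refine HasDerivAt.congr_deriv (((((hm i).mul (hm j)).div hH hne).add
        ((((hH.pow 2).const_mul (g / 2)).add (((hs.pow 4).div hH hne).const_mul G)).mul_const
          _)).sub (((hT i j).div hH hne).const_mul G)) ?_
      simp
      field_simp
    · refine HasDerivAt.congr_deriv ((((hm j).mul (hW i α)).sub ((hW j α).mul (hm i))).div
        hH hne) ?_
      simp
      field_simp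
    · refine HasDerivAt.congr_deriv (((hm j).mul (hR l)).div hH hne) ?_
      simp
      field_simp
    · refine HasDerivAt.congr_deriv (((hm j).mul hs).div hH hne) ?_
      simp
      field_simp

theorem fderiv_svmEnergyFlux (g G : ℝ) (j : Fin 2) {q : SvmState} (hq : q ∈ AHPlus)
    (v : SvmState) : fderiv ℝ (svmEnergyFlux g G j) q v
      = energyFluxDeriv g G j q v (stretchCoeff q) (fderiv ℝ stretchCoeff q v) := by
  have h0 : q.1 ≠ 0 := hq.1.ne'
  have hne : q.1 + (0 : ℝ) • v.1 ≠ 0 := by simpa using h0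
  have hH : HasDerivAt (fun s : ℝ => q.1 + s • v.1) v.1 0 := hasDerivAt_line q.1 v.1 0
  have hm : ∀ i, HasDerivAt (fun s : ℝ => q.2.1 i + s • v.2.1 i) (v.2.1 i) 0 :=
    fun i => hasDerivAt_line _ _ 0
  have hs : HasDerivAt (fun s : ℝ => q.2.2.2.2 + s • v.2.2.2.2) v.2.2.2.2 0 :=
    hasDerivAt_line _ _ 0
  have hT : ∀ i j, HasDerivAt
      (fun s : ℝ => congrEntry (q + s • v).2.2.1 (stretchCoeff (q + s • v)) i j) _ 0 :=
    fun i j => hasDerivAt_congrEntry (hasDerivAt_stretchCoeff hq v) i j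
  have hE := hasDerivAt_energyFormula g G hq v
  refine fderiv_apply_eq_of_line ((contDiffAt_svmEnergyFlux (n := 1) g G j hq).differentiableAt
    one_ne_zero) (h := fun s : ℝ => (q.2.1 j + s • v.2.1 j) / (q.1 + s • v.1)
      * (energyFormula g G (q + s • v) (stretchCoeff (q + s • v)) + g / 2 * (q.1 + s • v.1) ^ 2)
        + G * ((q.2.2.2.2 + s • v.2.2.2.2) ^ 4 * (q.2.1 j + s • v.2.1 j)) / (q.1 + s • v.1) ^ 2
        - G * (congrEntry (q + s • v).2.2.1 (stretchCoeff (q + s • v)) j 0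
            * (q.2.1 0 + s • v.2.1 0)
          + congrEntry (q + s • v).2.2.1 (stretchCoeff (q + s • v)) j 1
            * (q.2.1 1 + s • v.2.1 1)) / (q.1 + s • v.1) ^ 2) ?_ ?_
  · filter_upwards [eventually_line_mem hq v] with s hs
    rw [svmEnergyFlux_eq g G j hs.1.ne', Fin.sum_univ_two]
    rfl
  · refine HasDerivAt.congr_deriv (((((hm j).div hH hne).mul
      (hE.add ((hH.pow 2).const_mul (g / 2)))).add
        ((((hs.pow 4).mul (hm j)).const_mul G).div (hH.pow 2) (pow_ne_zero 2 hne))).sub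
        (((((hT j 0).mul (hm 0)).add ((hT j 1).mul (hm 1))).const_mul G).div (hH.pow 2)
          (pow_ne_zero 2 hne))) ?_
    simp [energyFluxDeriv, Fin.sum_univ_two]
    generalize energyDeriv g G q v (stretchCoeff q) (fderiv ℝ stretchCoeff q v) = e
    generalize energyFormula g G q (stretchCoeff q) = e'
    field_simp
    ring

/-! ### Compatibility of the functional with the fluxes -/

/-- The matrix `A` depends on `Y` alone, and `Y` is advected: the terms with the variation of the
mass flux cancel in the quotient `HY / H`, which leaves the factor `Uʲ`. -/
theorem fderiv_stretchCoeff_fluxDeriv (g G : ℝ) (j : Fin 2) {q : SvmState} (hq : q ∈ AHPlus)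
    (v : SvmState) (a b : Fin 3 → ℝ) :
    fderiv ℝ stretchCoeff q (fluxDeriv g G j q v a b)
      = (q.2.1 j / q.1) • fderiv ℝ stretchCoeff q v := by
  have h0 : q.1 ≠ 0 := hq.1.ne'
  rw [fderiv_stretchCoeff hq, fderiv_stretchCoeff hq v, ← map_smul]
  congr 1
  funext l
  simp only [fluxDeriv, Pi.smul_apply, smul_eq_mul]
  field_simp
  ring

/-- The multiplier of the constraint in the compatibility relation. -/
def piolaMultiplier (G : ℝ) (q : SvmState) : (Fin 2 → ℝ) →L[ℝ] ℝ :=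
  (-(G / q.1 ^ 2) * ∑ i, q.2.1 i * (stretchCoeff q 0 * q.2.2.1 i 0 + stretchCoeff q 1 * q.2.2.1 i 1))
      • ContinuousLinearMap.proj (R := ℝ) (φ := fun _ : Fin 2 => ℝ) 0
    + (-(G / q.1 ^ 2) * ∑ i, q.2.1 i * (stretchCoeff q 1 * q.2.2.1 i 0
        + stretchCoeff q 2 * q.2.2.1 i 1))
      • ContinuousLinearMap.proj (R := ℝ) (φ := fun _ : Fin 2 => ℝ) 1

theorem contDiffAt_piolaMultiplier {n : WithTop ℕ∞} (G : ℝ) {q : SvmState} (hq : q ∈ AHPlus) :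
    ContDiffAt ℝ n (piolaMultiplier G) q := by
  have h0 : q.1 ≠ 0 := hq.1.ne'
  have h := contDiffAt_pi.1 (contDiffAt_stretchCoeff (n := n) hq)
  have h1 := h 0
  have h2 := h 1
  have h3 := h 2
  unfold piolaMultiplier
  fun_prop (disch := simpa using h0)

/-- The conserved variables `(H, HU, HF, HY, HYcc)` of the state `(H, U, F, Y, Ycc)`. -/
def scaleState (H : ℝ) (u : Fin 2 → ℝ) (f : Fin 2 → Fin 2 → ℝ) (y : Fin 3 → ℝ) (c : ℝ) :
    SvmState := (H, fun i => H * u i, fun i α => H * f i α, fun l => H * y l, H * c)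

/-- The variation of `scaleState H u f y c` for the variation `(H e, u', f', y', c')`. -/
def scaleVariation (H : ℝ) (u : Fin 2 → ℝ) (f : Fin 2 → Fin 2 → ℝ) (y : Fin 3 → ℝ) (c e : ℝ)
    (u' : Fin 2 → ℝ) (f' : Fin 2 → Fin 2 → ℝ) (y' : Fin 3 → ℝ) (c' : ℝ) : SvmState :=
  scaleState H (u' + e • u) (f' + e • f) (y' + e • y) (c' + e * c) + (H * e - H, 0)

/-- In primitive variables, with the relative variation `e` of `H`, the quotients by `H` disappear,
and the compatibility relation becomes manageable for `field_simp` and `ring`. -/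
theorem exists_eq_scaleState {q : SvmState} (h0 : q.1 ≠ 0) (v : SvmState) :
    ∃ u f y c e u' f' y' c', q = scaleState q.1 u f y c
      ∧ v = scaleVariation q.1 u f y c e u' f' y' c' := by
  obtain ⟨H, m, W, R, s⟩ := q
  obtain ⟨h, n, V, S, z⟩ := v
  have h0 : H ≠ 0 := h0
  refine ⟨fun i => m i / H, fun i α => W i α / H, fun l => R l / H, s / H, h / H,
    fun i => (n i - m i / H * h) / H, fun i α => (V i α - W i α / H * h) / H,
    fun l => (S l - R l / H * h) / H, (z - s / H * h) / H, ?_, ?_⟩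
  · refine Prod.ext rfl (Prod.ext ?_ (Prod.ext ?_ (Prod.ext ?_ ?_)))
    · funext i; simp only [scaleState]; field_simp
    · funext i α; simp only [scaleState]; field_simp
    · funext i; simp only [scaleState]; field_simp
    · simp only [scaleState]; field_simp
  · refine Prod.ext ?_ (Prod.ext ?_ (Prod.ext ?_ (Prod.ext ?_ ?_)))
    · simp [scaleVariation, scaleState]; field_simp
    · funext i; simp [scaleVariation, scaleState]; field_simp; ring
    · funext i α; simp [scaleVariation, scaleState]; field_simp; ring
    · funext i; simp [scaleVariation, scaleState]; field_simp; ring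
    · simp [scaleVariation, scaleState]; field_simp; ring

theorem energyFormula_scaleState (g G : ℝ) {H : ℝ} (hH : H ≠ 0) (u : Fin 2 → ℝ)
    (f : Fin 2 → Fin 2 → ℝ) (y : Fin 3 → ℝ) (c : ℝ) (a : Fin 3 → ℝ) :
    energyFormula g G (scaleState H u f y c) a = H / 2 * (u 0 ^ 2 + u 1 ^ 2 + g * H
      + G * (congrEntry f a 0 0 + congrEntry f a 1 1) + G * c ^ 4 * H ^ 2
      + (y 0 ^ 2 + 2 * y 1 ^ 2 + y 2 ^ 2)) := by
  simp only [energyFormula, scaleState, congrEntry]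
  field_simp
  ring

theorem energyDeriv_scaleState (g G : ℝ) {H : ℝ} (hH : H ≠ 0) (u : Fin 2 → ℝ)
    (f : Fin 2 → Fin 2 → ℝ) (y : Fin 3 → ℝ) (c e : ℝ)
    (u' : Fin 2 → ℝ) (f' : Fin 2 → Fin 2 → ℝ) (y' : Fin 3 → ℝ) (c' : ℝ) (a b : Fin 3 → ℝ) :
    energyDeriv g G (scaleState H u f y c) (scaleVariation H u f y c e u' f' y' c') a b
      = H * e * (u 0 ^ 2 + u 1 ^ 2 + 2 * g * H + G * (congrEntry f a 0 0 + congrEntry f a 1 1)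
          + 3 * G * c ^ 4 * H ^ 2 + (y 0 ^ 2 + 2 * y 1 ^ 2 + y 2 ^ 2)) / 2
        + H * (u 0 * u' 0 + u 1 * u' 1
          + G / 2 * (congrEntryDeriv f f' a b 0 0 + congrEntryDeriv f f' a b 1 1)
          + 2 * G * c ^ 3 * H ^ 2 * c' + (y 0 * y' 0 + 2 * y 1 * y' 1 + y 2 * y' 2)) := by
  simp [energyDeriv, scaleState, scaleVariation, congrEntry, congrEntryDeriv]
  field_simp
  ring

theorem fluxDeriv_scaleState (g G : ℝ) (j : Fin 2) {H : ℝ} (hH : H ≠ 0) (u : Fin 2 → ℝ)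
    (f : Fin 2 → Fin 2 → ℝ) (y : Fin 3 → ℝ) (c e : ℝ)
    (u' : Fin 2 → ℝ) (f' : Fin 2 → Fin 2 → ℝ) (y' : Fin 3 → ℝ) (c' : ℝ) (a b : Fin 3 → ℝ) :
    fluxDeriv g G j (scaleState H u f y c) (scaleVariation H u f y c e u' f' y' c') a b
      = scaleVariation H u f y c (u' j + e * u j)
        (fun i => u j * u' i + (g * H * e + G * (4 * c ^ 3 * c' * H ^ 2 + 3 * c ^ 4 * H ^ 2 * e))
            * (1 : Matrix (Fin 2) (Fin 2) ℝ) i j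
          - G * (e * congrEntry f a i j + congrEntryDeriv f f' a b i j))
        (fun i α => u j * f' i α - (e * f j α * u i + f' j α * u i + f j α * u' i))
        (fun l => u j * y' l) (u j * c') := by
  refine Prod.ext ?_ (Prod.ext ?_ (Prod.ext ?_ (Prod.ext ?_ ?_)))
  · simp [fluxDeriv, scaleState, scaleVariation]
  · funext i
    generalize hδ : (1 : Matrix (Fin 2) (Fin 2) ℝ) i j = δ
    simp [fluxDeriv, scaleState, scaleVariation, congrEntry, congrEntryDeriv, hδ]
    field_simp
    ring
  · funext i α
    simp [fluxDeriv, scaleState, scaleVariation]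
    field_simp
    ring
  · funext l
    simp [fluxDeriv, scaleState, scaleVariation]
    field_simp
    ring
  · simp [fluxDeriv, scaleState, scaleVariation]
    field_simp
    ring

/-- The variation `b` of `A` is arbitrary: only its advection with factor `Uʲ` matters, not how `A`
depends on `Y`. With `W = HF`, the one contribution not matched by the energy flux is the term `-U^i
δW_j` of the flux of `W`, paired with the derivative `G A W_i / H` of the functional; this is the
multiplier of the constraint. -/
theorem energyDeriv_fluxDeriv (g G : ℝ) (j : Fin 2) {q : SvmState} (h0 : q.1 ≠ 0)
    (v : SvmState) (b : Fin 3 → ℝ) :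
    energyDeriv g G q (fluxDeriv g G j q v (stretchCoeff q) b) (stretchCoeff q)
        ((q.2.1 j / q.1) • b)
      = energyFluxDeriv g G j q v (stretchCoeff q) b + piolaMultiplier G q (v.2.2.1 j) := by
  have hΞ : piolaMultiplier G q (v.2.2.1 j) = -(G / q.1 ^ 2)
      * ((q.2.1 0 * (stretchCoeff q 0 * q.2.2.1 0 0 + stretchCoeff q 1 * q.2.2.1 0 1)
        + q.2.1 1 * (stretchCoeff q 0 * q.2.2.1 1 0 + stretchCoeff q 1 * q.2.2.1 1 1))
          * v.2.2.1 j 0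
      + (q.2.1 0 * (stretchCoeff q 1 * q.2.2.1 0 0 + stretchCoeff q 2 * q.2.2.1 0 1)
        + q.2.1 1 * (stretchCoeff q 1 * q.2.2.1 1 0 + stretchCoeff q 2 * q.2.2.1 1 1))
          * v.2.2.1 j 1) := by
    simp [piolaMultiplier, Fin.sum_univ_two]
    ring
  rw [hΞ]
  generalize stretchCoeff q = a
  obtain ⟨u, f, y, c, e, u', f', y', c', hq, hv⟩ := exists_eq_scaleState h0 v
  generalize q.1 = H at h0 hq hv
  subst hq hv
  have hu : (scaleState H u f y c).2.1 j / (scaleState H u f y c).1 = u j :=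
    mul_div_cancel_left₀ _ h0
  have hu' : (scaleState H u f y c).2.1 j / H = u j := hu
  rw [hu', fluxDeriv_scaleState g G j h0, energyDeriv_scaleState g G h0, energyFluxDeriv, hu,
    energyDeriv_scaleState g G h0, energyFormula_scaleState g G h0]
  simp only [Fin.sum_univ_two]
  obtain rfl | rfl : j = 0 ∨ j = 1 := by omega
  · simp [scaleState, scaleVariation, congrEntry, congrEntryDeriv]
    field_simp
    ring
  · simp [scaleState, scaleVariation, congrEntry, congrEntryDeriv]
    field_simp
    ring

theorem svmEnergy_compatible (g G : ℝ) {q : SvmState} (hq : q ∈ AHPlus) (j : Fin 2) :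
    (fderiv ℝ (svmEnergy g G) q).comp (fderiv ℝ (svm1Flux g G j) q)
      = fderiv ℝ (svmEnergyFlux g G j) q + (piolaMultiplier G q).comp (piolaMap j) := by
  refine ContinuousLinearMap.ext fun v => ?_
  change fderiv ℝ (svmEnergy g G) q (fderiv ℝ (svm1Flux g G j) q v)
    = fderiv ℝ (svmEnergyFlux g G j) q v + piolaMultiplier G q (v.2.2.1 j)
  rw [fderiv_svmEnergy g G hq, fderiv_svm1Flux g G j hq, fderiv_svmEnergyFlux g G j hq,
    fderiv_stretchCoeff_fluxDeriv g G j hq, energyDeriv_fluxDeriv g G j hq.1.ne']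

theorem isEntropyPair_svmEnergy (g G : ℝ) :
    IsEntropyPair (svm1Flux g G) piolaMap AHPlus (svmEnergy g G) (svmEnergyFlux g G) :=
  ⟨fun _ hq => (contDiffAt_svmEnergy g G hq).contDiffWithinAt,
    fun j _ hq => (contDiffAt_svmEnergyFlux g G j hq).contDiffWithinAt,
    piolaMultiplier G, fun _ hq => (contDiffAt_piolaMultiplier G hq).contDiffWithinAt,
    fun _ hq j => svmEnergy_compatible g G hq j⟩

/-- The flux of `HF` is antisymmetric in the spatial indices `i, j`, and the equation for `HF` has
no source. -/
theorem isInvolution_piolaMap (g G k lam : ℝ) :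
    IsInvolution (svm1Flux g G) (svm1Source g k lam) piolaMap AHPlus := by
  refine ⟨fun q _ i j => ?_, fun _ _ _ _ => rfl⟩
  funext α
  change ((primA q).vec j * q.mat i α - q.mat j α * (primA q).vec i)
    + ((primA q).vec i * q.mat j α - q.mat i α * (primA q).vec j) = 0
  ring

/-! ### Second derivatives along lines -/

/-- `a`, `b`, `c` are the values at `0` of `f` and of its first two derivatives. -/
def HasJet (f : ℝ → ℝ) (a b c : ℝ) : Prop :=
  f 0 = a ∧ ∃ f' : ℝ → ℝ, (∀ᶠ t in nhds 0, HasDerivAt f (f' t) t) ∧ f' 0 = b ∧ HasDerivAt f' c 0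

namespace HasJet

variable {f h : ℝ → ℝ} {a b c a' b' c' : ℝ}

theorem add (hf : HasJet f a b c) (hh : HasJet h a' b' c') :
    HasJet (fun t => f t + h t) (a + a') (b + b') (c + c') := by
  obtain ⟨rfl, f', hf1, rfl, hf2⟩ := hf
  obtain ⟨rfl, h', hh1, rfl, hh2⟩ := hh
  refine ⟨rfl, fun t => f' t + h' t, ?_, rfl, hf2.add hh2⟩
  filter_upwards [hf1, hh1] with t h1 h2 using h1.add h2

theorem mul (hf : HasJet f a b c) (hh : HasJet h a' b' c') :
    HasJet (fun t => f t * h t) (a * a') (b * a' + a * b') (c * a' + 2 * (b * b') + a * c') := by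
  obtain ⟨rfl, f', hf1, rfl, hf2⟩ := hf
  obtain ⟨rfl, h', hh1, rfl, hh2⟩ := hh
  refine ⟨rfl, fun t => f' t * h t + f t * h' t, ?_, rfl, ?_⟩
  · filter_upwards [hf1, hh1] with t h1 h2 using h1.mul h2
  · refine ((hf2.mul hh1.self_of_nhds).add (hf1.self_of_nhds.mul hh2)).congr_deriv ?_
    ring

theorem const_mul (r : ℝ) (hf : HasJet f a b c) :
    HasJet (fun t => r * f t) (r * a) (r * b) (r * c) := by
  obtain ⟨rfl, f', hf1, rfl, hf2⟩ := hf
  refine ⟨rfl, fun t => r * f' t, ?_, rfl, hf2.const_mul r⟩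
  filter_upwards [hf1] with t h1 using h1.const_mul r

theorem line (x v : ℝ) : HasJet (fun t => x + t • v) x v 0 :=
  ⟨by simp, fun _ => v, Filter.Eventually.of_forall fun t => hasDerivAt_line x v t, rfl,
    hasDerivAt_const _ _⟩

theorem inv_line {x v : ℝ} (hx : x ≠ 0) :
    HasJet (fun t => (x + t • v)⁻¹) x⁻¹ (-v / x ^ 2) (2 * v ^ 2 / x ^ 3) := by
  have hne : ∀ᶠ t : ℝ in nhds 0, x + t • v ≠ 0 :=
    (hasDerivAt_line x v 0).continuousAt.eventually_ne (by simpa using hx)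
  refine ⟨by simp, fun t => -v / (x + t • v) ^ 2, ?_, by simp, ?_⟩
  · filter_upwards [hne] with t ht using (hasDerivAt_line x v t).inv ht
  · refine ((hasDerivAt_const (0 : ℝ) (-v)).div ((hasDerivAt_line x v 0).pow 2)
      (by simpa using hx)).congr_deriv ?_
    simp
    field_simp

theorem of_contDiffAt (hf : ContDiffAt ℝ 2 f 0) :
    HasJet f (f 0) (deriv f 0) (deriv (deriv f) 0) := by
  refine ⟨rfl, deriv f, ?_, rfl, ?_⟩
  · filter_upwards [hf.eventually (by simp)] with t ht
    exact (ht.differentiableAt two_ne_zero).hasDerivAt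
  · have h1 : ContDiffAt ℝ 1 (deriv f) 0 := by
      have : ContDiffAt ℝ 1 (fderiv ℝ f) 0 := hf.fderiv_right (by norm_num)
      exact (this.clm_apply contDiffAt_const)
    exact (h1.differentiableAt one_ne_zero).hasDerivAt

/-- Comparing the jets of the two sides of an identity yields the identity together with its first
two derivatives; this is how implicit relations are differentiated below. -/
theorem unique (hf : HasJet f a b c) (hh : HasJet h a' b' c') (he : f =ᶠ[nhds 0] h) :
    a = a' ∧ b = b' ∧ c = c' := by
  obtain ⟨rfl, f', hf1, rfl, hf2⟩ := hf
  obtain ⟨rfl, h', hh1, rfl, hh2⟩ := hh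
  have hd : f' =ᶠ[nhds 0] h' := by
    filter_upwards [hf1, hh1, he.eventuallyEq_nhds] with t h1 h2 h3
    exact h1.unique (h2.congr_of_eventuallyEq h3)
  exact ⟨he.self_of_nhds, hd.self_of_nhds, hf2.unique (hh2.congr_of_eventuallyEq hd)⟩

theorem congr (hf : HasJet f a b c) (he : h =ᶠ[nhds 0] f) : HasJet h a b c := by
  obtain ⟨rfl, f', hf1, rfl, hf2⟩ := hf
  refine ⟨he.self_of_nhds, f', ?_, rfl, hf2⟩
  filter_upwards [hf1, he.eventuallyEq_nhds] with t h1 h2 using h1.congr_of_eventuallyEq h2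

/-- The second derivative along a line, from the second Fréchet derivative. -/
theorem of_fderiv {E : Type*} [NormedAddCommGroup E] [NormedSpace ℝ E] {η : E → ℝ} {q : E}
    (hη : ContDiffAt ℝ 2 η q) (v : E) :
    HasJet (fun t => η (q + t • v)) (η q) (fderiv ℝ η q v) (fderiv ℝ (fderiv ℝ η) q v v) := by
  refine ⟨by simp, fun t => fderiv ℝ η (q + t • v) v, ?_, by simp, ?_⟩
  · have h1 : ∀ᶠ t : ℝ in nhds 0, ContDiffAt ℝ 2 η (q + t • v) :=
      (hasDerivAt_line q v 0).continuousAt.eventually (by simpa using hη.eventually (by simp))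
    filter_upwards [h1] with t ht
    exact (ht.differentiableAt two_ne_zero).hasFDerivAt.comp_hasDerivAt t (hasDerivAt_line q v t)
  · have h1 : ContDiffAt ℝ 1 (fderiv ℝ η) q := hη.fderiv_right (by norm_num)
    exact ((h1.differentiableAt one_ne_zero).hasFDerivAt.hasDerivAt_line (v := v)).clm_apply
      (hasDerivAt_const _ v) |>.congr_deriv (by simp)

end HasJet

/-! ### Concavity of the matrix root and convexity of the functional -/

/-- The solution `X` of the Lyapunov equation `K X + X K = 2 J²` is nonnegative. -/
theorem lyapunov_nonneg {k j x : Fin 3 → ℝ} (hk : (symMat k).PosDef)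
    (e00 : k 0 * x 0 + k 1 * x 1 = j 0 ^ 2 + j 1 ^ 2)
    (e01 : k 0 * x 1 + k 1 * x 2 + x 0 * k 1 + x 1 * k 2 = 2 * (j 1 * (j 0 + j 2)))
    (e11 : k 1 * x 1 + k 2 * x 2 = j 1 ^ 2 + j 2 ^ 2) (y z : ℝ) :
    0 ≤ x 0 * y ^ 2 + 2 * x 1 * y * z + x 2 * z ^ 2 := by
  have hd := ((symMat_posDef_iff k).1 hk).2
  have ht := symMat_posDef_trace_pos hk
  -- In dimension two the solution is explicit: `tr K det K X = det K J² + adj K J² adj K`. Tested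
  -- on a vector `v = (y, z)`, the right side is `det K |J v|² + |J adj K v|²`.
  have key : (k 0 + k 2) * (k 0 * k 2 - k 1 ^ 2) * (x 0 * y ^ 2 + 2 * x 1 * y * z + x 2 * z ^ 2)
      = (k 0 * k 2 - k 1 ^ 2) * ((j 0 * y + j 1 * z) ^ 2 + (j 1 * y + j 2 * z) ^ 2)
        + ((j 0 * (k 2 * y - k 1 * z) + j 1 * (k 0 * z - k 1 * y)) ^ 2
          + (j 1 * (k 2 * y - k 1 * z) + j 2 * (k 0 * z - k 1 * y)) ^ 2) := by
    linear_combination ((k 0 * k 2 - k 1 ^ 2) * y ^ 2 + (k 2 * y - k 1 * z) ^ 2) * e00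
      + ((k 0 * k 2 - k 1 ^ 2) * y * z + (k 2 * y - k 1 * z) * (k 0 * z - k 1 * y)) * e01
      + ((k 0 * k 2 - k 1 ^ 2) * z ^ 2 + (k 0 * z - k 1 * y) ^ 2) * e11
  have hpos : 0 < (k 0 + k 2) * (k 0 * k 2 - k 1 ^ 2) := mul_pos ht hd
  by_contra hneg
  have h1 := mul_neg_of_pos_of_neg hpos (not_le.1 hneg)
  rw [key] at h1
  have h2 := hd.le
  have : 0 ≤ (k 0 * k 2 - k 1 ^ 2) * ((j 0 * y + j 1 * z) ^ 2 + (j 1 * y + j 2 * z) ^ 2) := by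
    positivity
  have := sq_nonneg (j 0 * (k 2 * y - k 1 * z) + j 1 * (k 0 * z - k 1 * y))
  have := sq_nonneg (j 1 * (k 2 * y - k 1 * z) + j 2 * (k 0 * z - k 1 * y))
  linarith

/-- Second order conditions for `K² = h R`, with `h` and `R` affine: `-K''` is nonnegative. -/
theorem sqrt_second_deriv_nonpos {k k' k'' r r' : Fin 3 → ℝ} {h h' : ℝ} (hh : 0 < h)
    (hk : (symMat k).PosDef)
    (a0 : k 0 * k 0 + k 1 * k 1 = h * r 0)
    (a1 : k 1 * (k 0 + k 2) = h * r 1)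
    (a2 : k 1 * k 1 + k 2 * k 2 = h * r 2)
    (b0 : 2 * (k 0 * k' 0) + 2 * (k 1 * k' 1) = h' * r 0 + h * r' 0)
    (b1 : k' 1 * (k 0 + k 2) + k 1 * (k' 0 + k' 2) = h' * r 1 + h * r' 1)
    (b2 : 2 * (k 1 * k' 1) + 2 * (k 2 * k' 2) = h' * r 2 + h * r' 2)
    (c0 : 2 * (k' 0 ^ 2 + k 0 * k'' 0) + 2 * (k' 1 ^ 2 + k 1 * k'' 1) = 2 * (h' * r' 0))
    (c1 : k'' 1 * (k 0 + k 2) + 2 * (k' 1 * (k' 0 + k' 2)) + k 1 * (k'' 0 + k'' 2)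
      = 2 * (h' * r' 1))
    (c2 : 2 * (k' 1 ^ 2 + k 1 * k'' 1) + 2 * (k' 2 ^ 2 + k 2 * k'' 2) = 2 * (h' * r' 2))
    (y z : ℝ) : k'' 0 * y ^ 2 + 2 * k'' 1 * y * z + k'' 2 * z ^ 2 ≤ 0 := by
  -- With `J = K' - ρ K`, the identities for `K²` and its derivative give `J² = K'² - h' R'`. The
  -- second derivative then reads `K X + X K = 2 J²` for `X = -K''`.
  obtain ⟨ρ, rfl⟩ : ∃ ρ, h' = ρ * h := ⟨h' / h, by field_simp⟩
  have := lyapunov_nonneg (k := k) (j := fun l => k' l - ρ * k l) (x := fun l => -k'' l) hk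
    (by linear_combination (-1 / 2) * c0 + ρ * b0 - ρ ^ 2 * a0)
    (by linear_combination -c1 + 2 * ρ * b1 - 2 * ρ ^ 2 * a1)
    (by linear_combination (-1 / 2) * c2 + ρ * b2 - ρ ^ 2 * a2) y z
  linarith

/-- Second derivative of `w ⬝ K⁻¹ w` for affine `w`: with `K γ = w` it is
`2 γ' ⬝ K γ' - γ ⬝ K'' γ`. -/
theorem row_second_deriv {k k' k'' : Fin 3 → ℝ} {γ γ' γ'' w w' : Fin 2 → ℝ}
    (p0 : k 0 * γ 0 + k 1 * γ 1 = w 0) (p1 : k 1 * γ 0 + k 2 * γ 1 = w 1)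
    (q0 : k' 0 * γ 0 + k 0 * γ' 0 + (k' 1 * γ 1 + k 1 * γ' 1) = w' 0)
    (q1 : k' 1 * γ 0 + k 1 * γ' 0 + (k' 2 * γ 1 + k 2 * γ' 1) = w' 1)
    (s0 : k'' 0 * γ 0 + 2 * (k' 0 * γ' 0) + k 0 * γ'' 0
      + (k'' 1 * γ 1 + 2 * (k' 1 * γ' 1) + k 1 * γ'' 1) = 0)
    (s1 : k'' 1 * γ 0 + 2 * (k' 1 * γ' 0) + k 1 * γ'' 0
      + (k'' 2 * γ 1 + 2 * (k' 2 * γ' 1) + k 2 * γ'' 1) = 0) :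
    2 * (w' 0 * γ' 0 + w' 1 * γ' 1) + (w 0 * γ'' 0 + w 1 * γ'' 1)
      = 2 * (k 0 * γ' 0 ^ 2 + 2 * k 1 * γ' 0 * γ' 1 + k 2 * γ' 1 ^ 2)
        - (k'' 0 * γ 0 ^ 2 + 2 * k'' 1 * γ 0 * γ 1 + k'' 2 * γ 1 ^ 2) := by
  linear_combination (-2 * γ' 0) * q0 + (-2 * γ' 1) * q1 - γ'' 0 * p0 - γ'' 1 * p1
    + γ 0 * s0 + γ 1 * s1

theorem symMat_quadratic_pos {k : Fin 3 → ℝ} (hk : (symMat k).PosDef) {y z : ℝ}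
    (h : y ≠ 0 ∨ z ≠ 0) : 0 < k 0 * y ^ 2 + 2 * k 1 * y * z + k 2 * z ^ 2 := by
  obtain ⟨h0, hd⟩ := (symMat_posDef_iff k).1 hk
  have key : k 0 * (k 0 * y ^ 2 + 2 * k 1 * y * z + k 2 * z ^ 2)
      = (k 0 * y + k 1 * z) ^ 2 + (k 0 * k 2 - k 1 ^ 2) * z ^ 2 := by ring
  refine (mul_pos_iff_of_pos_left h0).1 ?_
  rw [key]
  by_cases hz : z = 0
  · have hy : y ≠ 0 := h.resolve_right (not_not.2 hz)
    have : 0 < (k 0 * y) ^ 2 := by positivity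
    simpa [hz] using this
  · positivity

/-- Second order data, along a line, of the functional `G/2 ∑ᵢ wᵢ ⬝ (H A⁻¹)⁻¹ wᵢ`. -/
theorem exists_stress_jet {q : SvmState} (hq : q ∈ AHPlus) (v : SvmState) :
    ∃ T T' T'' : ℝ, HasJet (fun t => (congrEntry (q + t • v).2.2.1 (stretchCoeff (q + t • v)) 0 0
        + congrEntry (q + t • v).2.2.1 (stretchCoeff (q + t • v)) 1 1) * (q.1 + t • v.1)⁻¹) T T' T''
      ∧ 0 ≤ T'' ∧ (v.1 = 0 → v.2.2.2.1 = 0 → T'' = 0 → v.2.2.1 = 0) := by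
  have h0 : 0 < q.1 := hq.1
  have hmem := eventually_line_mem hq v
  have hapd : (symMat (stretchCoeff q)).PosDef := symMat_invSqrtCoeff_posDef hq.2.1
  have hdet := ((symMat_posDef_iff _).1 hapd).2
  let a : ℝ → Fin 3 → ℝ := fun t => stretchCoeff (q + t • v)
  let η : ℝ → ℝ := fun t => q.1 + t • v.1
  let D : ℝ → ℝ := fun t => a t 0 * a t 2 - a t 1 ^ 2
  let W : ℝ → Fin 2 → Fin 2 → ℝ := fun t i α => q.2.2.1 i α + t • v.2.2.1 i α
  -- Here `K = H A⁻¹`, written with the adjugate of `A`, and `γ i = K⁻¹ w = A w / H` for the `i`-th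
  -- row `w` of `HF`.
  let k : ℝ → Fin 3 → ℝ := fun t => ![η t * a t 2 / D t, -(η t * a t 1) / D t, η t * a t 0 / D t]
  let γ : ℝ → Fin 2 → Fin 2 → ℝ := fun t i => ![(a t 0 * W t i 0 + a t 1 * W t i 1) / η t,
    (a t 1 * W t i 0 + a t 2 * W t i 1) / η t]
  have hη : HasJet η q.1 v.1 0 := HasJet.line _ _
  have hW : ∀ i α, HasJet (fun t => W t i α) (q.2.2.1 i α) (v.2.2.1 i α) 0 :=
    fun i α => HasJet.line _ _
  have hR : ∀ l, HasJet (fun t : ℝ => q.2.2.2.1 l + t • v.2.2.2.1 l) (q.2.2.2.1 l)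
      (v.2.2.2.1 l) 0 := fun l => HasJet.line _ _
  have hline : ∀ x y : ℝ, ContDiffAt ℝ 2 (fun t : ℝ => x + t • y) 0 := fun x y => by fun_prop
  have hac : ∀ l, ContDiffAt ℝ 2 (fun t => a t l) 0 := by
    intro l
    have h1 : ContDiffAt ℝ 2 (fun t : ℝ => q + t • v) 0 := by fun_prop
    have h2 : ContDiffAt ℝ 2 (fun r => stretchCoeff r l) (q + (0 : ℝ) • v) := by
      simpa using contDiffAt_pi.1 (contDiffAt_stretchCoeff (n := 2) hq) l
    exact ContDiffAt.comp (g := fun r => stretchCoeff r l) (0 : ℝ) h2 h1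
  have hηc : ContDiffAt ℝ 2 η 0 := hline _ _
  have hη0 : η 0 ≠ 0 := by simpa [η] using h0.ne'
  have hD0 : D 0 ≠ 0 := by simpa [D, a] using hdet.ne'
  have hDc : ContDiffAt ℝ 2 D 0 := ((hac 0).mul (hac 2)).sub ((hac 1).pow 2)
  have hkc : ∀ l, ContDiffAt ℝ 2 (fun t => k t l) 0 := by
    intro l
    fin_cases l
    · exact (hηc.mul (hac 2)).div hDc hD0
    · exact (hηc.mul (hac 1)).neg.div hDc hD0
    · exact (hηc.mul (hac 0)).div hDc hD0
  have hγc : ∀ i α, ContDiffAt ℝ 2 (fun t => γ t i α) 0 := by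
    intro i α
    fin_cases α
    · exact (((hac 0).mul (hline _ _)).add ((hac 1).mul (hline _ _))).div hηc hη0
    · exact (((hac 1).mul (hline _ _)).add ((hac 2).mul (hline _ _))).div hηc hη0
  have hk := fun l => HasJet.of_contDiffAt (hkc l)
  have hγ := fun i α => HasJet.of_contDiffAt (hγc i α)
  have hne : ∀ᶠ t in nhds (0 : ℝ), η t ≠ 0 ∧ D t ≠ 0 ∧
      invSqCoeff (a t) = (primY (q + t • v)).symCoeff := by
    filter_upwards [hmem] with t ht
    have := symMat_invSqrtCoeff_posDef ht.2.1
    exact ⟨ht.1.ne', ((symMat_posDef_iff _).1 this).2.ne', invSqCoeff_invSqrtCoeff ht.2.1⟩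
  -- This is `K² = H R` with `R = HY`, because `A⁻² = Y`. Both factors on the right are affine in
  -- `t`.
  have kk : ∀ᶠ t in nhds (0 : ℝ), k t 0 * k t 0 + k t 1 * k t 1
        = η t * (q.2.2.2.1 0 + t • v.2.2.2.1 0)
      ∧ k t 1 * (k t 0 + k t 2) = η t * (q.2.2.2.1 1 + t • v.2.2.2.1 1)
      ∧ k t 1 * k t 1 + k t 2 * k t 2 = η t * (q.2.2.2.1 2 + t • v.2.2.2.1 2) := by
    filter_upwards [hne] with t ⟨h1, h2, h3⟩
    have e : ∀ l, q.2.2.2.1 l + t • v.2.2.2.1 l = η t * invSqCoeff (a t) l := by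
      intro l
      rw [h3]
      exact (mul_div_cancel₀ (q.2.2.2.1 l + t • v.2.2.2.1 l) h1).symm
    have d0 : invSqCoeff (a t) 0 = (a t 1 ^ 2 + a t 2 ^ 2) / D t ^ 2 := rfl
    have d1 : invSqCoeff (a t) 1 = -(a t 1 * (a t 0 + a t 2)) / D t ^ 2 := rfl
    have d2 : invSqCoeff (a t) 2 = (a t 0 ^ 2 + a t 1 ^ 2) / D t ^ 2 := rfl
    rw [e, e, e, d0, d1, d2]
    simp only [k, Matrix.cons_val]
    refine ⟨?_, ?_, ?_⟩ <;> field_simp <;> ring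
  have kγ : ∀ᶠ t in nhds (0 : ℝ), ∀ i, k t 0 * γ t i 0 + k t 1 * γ t i 1 = W t i 0
      ∧ k t 1 * γ t i 0 + k t 2 * γ t i 1 = W t i 1 := by
    filter_upwards [hne] with t ⟨h1, h2, h3⟩ i
    simp only [k, γ, Matrix.cons_val]
    constructor <;> field_simp <;> simp only [D] <;> ring
  have hkpd : (symMat (k 0)).PosDef := by
    rw [symMat_posDef_iff]
    have ha2 : 0 < a 0 2 := by
      have : 0 < stretchCoeff q 2 := hapd.diag_pos (i := 1)
      simpa [a] using this
    have hηp : 0 < η 0 := by simpa [η] using h0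
    have hDp : 0 < D 0 := by simpa [D, a] using hdet
    refine ⟨?_, ?_⟩
    · simp only [k, Matrix.cons_val]
      positivity
    · have : k 0 0 * k 0 2 - k 0 1 ^ 2 = η 0 ^ 2 / D 0 := by
        simp only [k, Matrix.cons_val]
        field_simp
        simp only [D]
        ring
      rw [this]
      positivity
  -- The relations `K² = H R` and `K γ = w` are now differentiated twice by comparison of jets.
  have u0 := (((hk 0).mul (hk 0)).add ((hk 1).mul (hk 1))).unique (hη.mul (hR 0))
    (kk.mono fun t h => h.1)
  have u1 := ((hk 1).mul ((hk 0).add (hk 2))).unique (hη.mul (hR 1)) (kk.mono fun t h => h.2.1)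
  have u2 := (((hk 1).mul (hk 1)).add ((hk 2).mul (hk 2))).unique (hη.mul (hR 2))
    (kk.mono fun t h => h.2.2)
  have w0 := fun i => (((hk 0).mul (hγ i 0)).add ((hk 1).mul (hγ i 1))).unique (hW i 0)
    (kγ.mono fun t h => (h i).1)
  have w1 := fun i => (((hk 1).mul (hγ i 0)).add ((hk 2).mul (hγ i 1))).unique (hW i 1)
    (kγ.mono fun t h => (h i).2)
  have hT := (((hW 0 0).mul (hγ 0 0)).add ((hW 0 1).mul (hγ 0 1))).add
    (((hW 1 0).mul (hγ 1 0)).add ((hW 1 1).mul (hγ 1 1)))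
  have row := fun i => row_second_deriv (k := k 0) (k' := fun l => deriv (fun t => k t l) 0)
    (k'' := fun l => deriv (deriv fun t => k t l) 0) (γ := γ 0 i)
    (γ' := fun α => deriv (fun t => γ t i α) 0)
    (γ'' := fun α => deriv (deriv fun t => γ t i α) 0) (w := q.2.2.1 i) (w' := v.2.2.1 i)
    (w0 i).1 (w1 i).1 (by linear_combination (w0 i).2.1) (by linear_combination (w1 i).2.1)
    (by linear_combination (w0 i).2.2) (by linear_combination (w1 i).2.2)
  have hconc := sqrt_second_deriv_nonpos (k := k 0) (k' := fun l => deriv (fun t => k t l) 0)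
    (k'' := fun l => deriv (deriv fun t => k t l) 0) (r := q.2.2.2.1) (r' := v.2.2.2.1)
    (h' := v.1) h0 hkpd u0.1 u1.1 u2.1
    (by linear_combination u0.2.1) (by linear_combination u1.2.1) (by linear_combination u2.2.1)
    (by linear_combination u0.2.2) (by linear_combination u1.2.2) (by linear_combination u2.2.2)
  have hquad : ∀ i, 0 ≤ k 0 0 * deriv (fun t => γ t i 0) 0 ^ 2
      + 2 * k 0 1 * deriv (fun t => γ t i 0) 0 * deriv (fun t => γ t i 1) 0
      + k 0 2 * deriv (fun t => γ t i 1) 0 ^ 2 := by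
    intro i
    by_cases h : deriv (fun t => γ t i 0) 0 ≠ 0 ∨ deriv (fun t => γ t i 1) 0 ≠ 0
    · exact (symMat_quadratic_pos hkpd h).le
    · push Not at h
      simp [h.1, h.2]
  refine ⟨_, _, _, hT.congr (Filter.Eventually.of_forall fun t => ?_), ?_, ?_⟩
  · simp only [congrEntry, γ, Matrix.cons_val]
    change (W t 0 0 * (a t 0 * W t 0 0 + a t 1 * W t 0 1)
      + W t 0 1 * (a t 1 * W t 0 0 + a t 2 * W t 0 1)
      + (W t 1 0 * (a t 0 * W t 1 0 + a t 1 * W t 1 1)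
      + W t 1 1 * (a t 1 * W t 1 0 + a t 2 * W t 1 1))) * (η t)⁻¹ = _
    ring
  · linarith [row 0, row 1, hquad 0, hquad 1, hconc (γ 0 0 0) (γ 0 0 1),
      hconc (γ 0 1 0) (γ 0 1 1)]
  -- Equality forces `γ' = 0` in each row. With `H` and `R` fixed, `K² = H R` gives `K K' + K' K =
  -- 0`, so `K' = 0`; then `w' = K' γ + K γ'` vanishes.
  · intro hv hR0 hT0
    have hq0 : ∀ i, k 0 0 * deriv (fun t => γ t i 0) 0 ^ 2
      + 2 * k 0 1 * deriv (fun t => γ t i 0) 0 * deriv (fun t => γ t i 1) 0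
      + k 0 2 * deriv (fun t => γ t i 1) 0 ^ 2 ≤ 0 := by
      have h1 := row 0
      have h2 := row 1
      have h3 := hquad 0
      have h4 := hquad 1
      have h5 := hconc (γ 0 0 0) (γ 0 0 1)
      have h6 := hconc (γ 0 1 0) (γ 0 1 1)
      intro i
      obtain rfl | rfl : i = 0 ∨ i = 1 := by omega
      · linarith
      · linarith
    have hγ0 : ∀ i, deriv (fun t => γ t i 0) 0 = 0 ∧ deriv (fun t => γ t i 1) 0 = 0 := by
      intro i
      by_contra h
      rw [not_and_or] at h
      exact absurd (symMat_quadratic_pos hkpd h) (not_lt.2 (hq0 i))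
    have hK0 : (fun l => deriv (fun t => k t l) 0) = 0 := by
      apply eq_zero_of_lyapunov hkpd
      have e0 := u0.2.1
      have e1 := u1.2.1
      have e2 := u2.2.1
      simp only [hv, hR0, Pi.zero_apply, zero_mul, mul_zero, add_zero] at e0 e1 e2
      ext i j
      fin_cases i <;> fin_cases j <;> simp [symMat] <;> linarith
    have hK := fun l => congrFun hK0 l
    simp only [Pi.zero_apply] at hK
    funext i α
    obtain rfl | rfl : α = 0 ∨ α = 1 := by omega
    · have := (w0 i).2.1
      simp only [hK, (hγ0 i).1, (hγ0 i).2] at this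
      simpa using this.symm
    · have := (w1 i).2.1
      simp only [hK, (hγ0 i).1, (hγ0 i).2] at this
      simpa using this.symm

/-- With `ρ = δH / H`, each term `x² / (2H)` contributes `(δx - ρ x)² / H`. Completing the square in
the second derivative of `s⁴ / (2H)` gives `s² ((ρ s - 2 δs)² + 2 δs²) / H`. The stress contributes
`T''`, whose vanishing is retained for the definiteness argument. -/
theorem svmEnergy_hessian_eq (g G : ℝ) {q : SvmState} (hq : q ∈ AHPlus) (v : SvmState) :
    ∃ ρ T'' : ℝ, v.1 = ρ * q.1 ∧ 0 ≤ T''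
      ∧ (v.1 = 0 → v.2.2.2.1 = 0 → T'' = 0 → v.2.2.1 = 0)
      ∧ fderiv ℝ (fderiv ℝ (svmEnergy g G)) q v v = g * v.1 ^ 2
      + ((v.2.1 0 - ρ * q.2.1 0) ^ 2 + (v.2.1 1 - ρ * q.2.1 1) ^ 2
        + (v.2.2.2.1 0 - ρ * q.2.2.2.1 0) ^ 2 + 2 * (v.2.2.2.1 1 - ρ * q.2.2.2.1 1) ^ 2
        + (v.2.2.2.1 2 - ρ * q.2.2.2.1 2) ^ 2
        + G * q.2.2.2.2 ^ 2 * ((ρ * q.2.2.2.2 - 2 * v.2.2.2.2) ^ 2 + 2 * v.2.2.2.2 ^ 2)) / q.1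
      + G / 2 * T'' := by
  have h0 : 0 < q.1 := hq.1
  obtain ⟨T, T', T'', hT, hTnn, hTz⟩ := exists_stress_jet hq v
  have hη : HasJet (fun t : ℝ => q.1 + t • v.1) q.1 v.1 0 := HasJet.line _ _
  have hi : HasJet (fun t : ℝ => (q.1 + t • v.1)⁻¹) _ _ _ := HasJet.inv_line h0.ne'
  have hm : ∀ i, HasJet (fun t : ℝ => q.2.1 i + t • v.2.1 i) (q.2.1 i) (v.2.1 i) 0 :=
    fun i => HasJet.line _ _
  have hR : ∀ l, HasJet (fun t : ℝ => q.2.2.2.1 l + t • v.2.2.2.1 l) (q.2.2.2.1 l)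
      (v.2.2.2.1 l) 0 := fun l => HasJet.line _ _
  have hs : HasJet (fun t : ℝ => q.2.2.2.2 + t • v.2.2.2.2) q.2.2.2.2 v.2.2.2.2 0 :=
    HasJet.line _ _
  have hs2 := hs.mul hs
  have hJ := (((hη.mul hη).const_mul (g / 2)).add
    (((((((hm 0).mul (hm 0)).add ((hm 1).mul (hm 1))).add ((hs2.mul hs2).const_mul G)).add
      ((((hR 0).mul (hR 0)).add (((hR 1).mul (hR 1)).const_mul 2)).add
        ((hR 2).mul (hR 2)))).mul hi).const_mul (1 / 2))).add (hT.const_mul (G / 2))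
  have hE := HasJet.of_fderiv (contDiffAt_svmEnergy (n := 2) g G hq) v
  have he := (hE.unique hJ (by
    filter_upwards [eventually_line_mem hq v] with t ht
    have hne : q.1 + t • v.1 ≠ 0 := ht.1.ne'
    rw [svmEnergy_eq g G ht.1.ne', energyFormula]
    change g / 2 * (q.1 + t • v.1) ^ 2 + ((q.2.1 0 + t • v.2.1 0) ^ 2 + (q.2.1 1 + t • v.2.1 1) ^ 2
      + G * (congrEntry (q + t • v).2.2.1 (stretchCoeff (q + t • v)) 0 0
        + congrEntry (q + t • v).2.2.1 (stretchCoeff (q + t • v)) 1 1)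
      + G * (q.2.2.2.2 + t • v.2.2.2.2) ^ 4
      + ((q.2.2.2.1 0 + t • v.2.2.2.1 0) ^ 2 + 2 * (q.2.2.2.1 1 + t • v.2.2.2.1 1) ^ 2
        + (q.2.2.2.1 2 + t • v.2.2.2.1 2) ^ 2)) / (2 * (q.1 + t • v.1)) = _
    field_simp
    ring)).2.2
  obtain ⟨ρ, hρ⟩ : ∃ ρ, v.1 = ρ * q.1 := ⟨v.1 / q.1, by field_simp⟩
  have key : fderiv ℝ (fderiv ℝ (svmEnergy g G)) q v v = g * v.1 ^ 2
      + ((v.2.1 0 - ρ * q.2.1 0) ^ 2 + (v.2.1 1 - ρ * q.2.1 1) ^ 2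
        + (v.2.2.2.1 0 - ρ * q.2.2.2.1 0) ^ 2 + 2 * (v.2.2.2.1 1 - ρ * q.2.2.2.1 1) ^ 2
        + (v.2.2.2.1 2 - ρ * q.2.2.2.1 2) ^ 2
        + G * q.2.2.2.2 ^ 2 * ((ρ * q.2.2.2.2 - 2 * v.2.2.2.2) ^ 2 + 2 * v.2.2.2.2 ^ 2)) / q.1
      + G / 2 * T'' := by
    rw [he, hρ]
    field_simp
    ring
  exact ⟨ρ, T'', hρ, hTnn, hTz, key⟩

/-- This is the degenerate case of the Hessian formula, in directions with `δH = 0` and hence `ρ =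
0`. -/
theorem weighted_squares_eq_zero {G H s x₀ x₁ x₂ x₃ x₄ z τ : ℝ} (hG : 0 < G) (hH : 0 < H)
    (hs : 0 < s) (hτ : 0 ≤ τ)
    (h : (x₀ ^ 2 + x₁ ^ 2 + x₂ ^ 2 + 2 * x₃ ^ 2 + x₄ ^ 2
      + G * s ^ 2 * ((-(2 * z)) ^ 2 + 2 * z ^ 2)) / H + τ ≤ 0) :
    x₀ = 0 ∧ x₁ = 0 ∧ x₂ = 0 ∧ x₃ = 0 ∧ x₄ = 0 ∧ z = 0 ∧ τ = 0 := by
  have n1 : 0 ≤ (x₀ ^ 2 + x₁ ^ 2 + x₂ ^ 2 + 2 * x₃ ^ 2 + x₄ ^ 2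
      + G * s ^ 2 * ((-(2 * z)) ^ 2 + 2 * z ^ 2)) / H := by positivity
  have hN := (div_eq_zero_iff.1 (le_antisymm (by linarith) n1)).resolve_right hH.ne'
  have hGs : 0 < G * s ^ 2 := by positivity
  have p0 := sq_nonneg x₀
  have p1 := sq_nonneg x₁
  have p2 := sq_nonneg x₂
  have p3 := sq_nonneg x₃
  have p4 := sq_nonneg x₄
  have p5 : 0 ≤ G * s ^ 2 * z ^ 2 := by positivity
  have hz : ∀ x : ℝ, x ^ 2 ≤ 0 → x = 0 := fun x hx =>
    pow_eq_zero_iff two_ne_zero |>.1 (le_antisymm hx (sq_nonneg x))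
  refine ⟨hz _ (by linarith), hz _ (by linarith), hz _ (by linarith), hz _ (by linarith),
    hz _ (by linarith), hz _ ?_, by linarith⟩
  have : G * s ^ 2 * z ^ 2 = 0 := by linarith
  exact ((mul_eq_zero.1 this).resolve_left hGs.ne').le

/-- The Hessian of the functional is positive definite. -/
theorem svmEnergy_hessian_pos {g G : ℝ} (hg : 0 < g) (hG : 0 < G) {q : SvmState}
    (hq : q ∈ AHPlus) {v : SvmState} (hv : v ≠ 0) :
    0 < fderiv ℝ (fderiv ℝ (svmEnergy g G)) q v v := by
  have h0 : 0 < q.1 := hq.1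
  have hs0 : 0 < q.2.2.2.2 := ((mem_AHPlus_iff q).1 hq).2.2
  obtain ⟨ρ, T'', hρ, hTnn, hTz, key⟩ := svmEnergy_hessian_eq g G hq v
  rw [key]
  have n2 : 0 ≤ G / 2 * T'' := by positivity
  -- When `δH ≠ 0` the term `g δH²` alone is positive. Otherwise, a nonpositive value annihilates
  -- all squares and `T''`, so the variations of `HU`, `HY`, `HYcc` vanish and then that of `HF`.
  by_cases h1 : v.1 = 0
  · have hρ0 : ρ = 0 := by
      rw [h1] at hρ
      exact (mul_eq_zero.1 hρ.symm).resolve_right h0.ne'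
    by_contra hneg
    simp only [h1, hρ0, zero_mul, sub_zero, zero_sub, zero_pow two_ne_zero, mul_zero, zero_add,
      not_lt] at hneg
    obtain ⟨e0, e1, e2, e3, e4, e5, e6⟩ := weighted_squares_eq_zero hG h0 hs0 n2 hneg
    have hT0 : T'' = 0 := (mul_eq_zero.1 e6).resolve_left (by positivity)
    have hm' : v.2.1 = 0 := by
      funext i
      obtain rfl | rfl : i = 0 ∨ i = 1 := by omega
      · exact e0
      · exact e1
    have hR' : v.2.2.2.1 = 0 := by
      funext i
      obtain rfl | rfl | rfl : i = 0 ∨ i = 1 ∨ i = 2 := by omega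
      · exact e2
      · exact e3
      · exact e4
    exact hv (Prod.ext h1 (Prod.ext hm' (Prod.ext (hTz h1 hR' hT0) (Prod.ext hR' e5))))
  · have : 0 < g * v.1 ^ 2 := by positivity
    refine add_pos_of_pos_of_nonneg (add_pos_of_pos_of_nonneg this ?_) n2
    refine div_nonneg ?_ h0.le
    have := hG.le
    positivity

/-! ### Strict convexity from the Hessian -/

/-- A function on an open convex set with positive definite second derivative is strictly
convex. -/
theorem strictConvexOn_of_hessian_pos {E : Type*} [NormedAddCommGroup E] [NormedSpace ℝ E]
    {D : Set E} {η : E → ℝ} (hD : Convex ℝ D) (hη : ∀ q ∈ D, ContDiffAt ℝ 2 η q)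
    (hpos : ∀ q ∈ D, ∀ v, v ≠ 0 → 0 < fderiv ℝ (fderiv ℝ η) q v v) : StrictConvexOn ℝ D η := by
  refine ⟨hD, fun x hx y hy hxy a b ha hb hab => ?_⟩
  have hv : y - x ≠ 0 := sub_ne_zero.2 hxy.symm
  let φ : ℝ → ℝ := fun t => η (x + t • (y - x))
  have hmem : ∀ t ∈ Set.Icc (0 : ℝ) 1, x + t • (y - x) ∈ D := fun t ht =>
    hD.add_smul_sub_mem hx hy ht
  have hjet : ∀ t ∈ Set.Icc (0 : ℝ) 1, ContDiffAt ℝ 2 φ t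
      ∧ deriv (deriv φ) t = fderiv ℝ (fderiv ℝ η) (x + t • (y - x)) (y - x) (y - x) := by
    intro t ht
    have h1 : ContDiffAt ℝ 2 (fun s : ℝ => x + s • (y - x)) t := by fun_prop
    have h2 : ContDiffAt ℝ 2 φ t := (hη _ (hmem t ht)).comp t h1
    refine ⟨h2, ?_⟩
    have h3 := HasJet.of_fderiv (hη _ (hmem t ht)) (y - x)
    -- Jets are taken at `0`, so the segment is reparametrized from its point of parameter `t`.
    have h4 : ContDiffAt ℝ 2 (fun s => φ (t + s)) 0 := by
      have : ContDiffAt ℝ 2 φ (t + 0) := by simpa using h2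
      exact ContDiffAt.comp (g := φ) (0 : ℝ) this (by fun_prop)
    have h5 := (HasJet.of_contDiffAt h4).unique h3 (Filter.Eventually.of_forall fun s => by
      simp only [φ]
      congr 1
      module)
    rw [← h5.2.2]
    have e1 : deriv (fun s => φ (t + s)) = fun s => deriv φ (t + s) := by
      funext s
      exact deriv_comp_const_add φ t s
    rw [e1, deriv_comp_const_add, add_zero]
  have hconv : StrictConvexOn ℝ (Set.Icc (0 : ℝ) 1) φ := by
    refine strictConvexOn_of_deriv2_pos' (convex_Icc 0 1)
      (fun t ht => (hjet t ht).1.continuousAt.continuousWithinAt) fun t ht => ?_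
    have : deriv^[2] φ t = deriv (deriv φ) t := rfl
    rw [this, (hjet t ht).2]
    exact hpos _ (hmem t ht) _ hv
  have := hconv.2 (Set.left_mem_Icc.2 zero_le_one) (Set.right_mem_Icc.2 zero_le_one)
    zero_ne_one ha hb hab
  simp only [φ, smul_eq_mul, mul_zero, mul_one, zero_add, zero_smul, add_zero, one_smul,
    add_sub_cancel] at this
  have e : a • x + b • y = x + b • (y - x) := by
    rw [← eq_sub_iff_add_eq] at hab
    rw [hab]
    module
  rw [e]
  exact this

theorem strictConvexOn_svmEnergy {g G : ℝ} (hg : 0 < g) (hG : 0 < G) :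
    StrictConvexOn ℝ AHPlus (svmEnergy g G) :=
  strictConvexOn_of_hessian_pos convex_AHPlus (fun _ hq => contDiffAt_svmEnergy g G hq)
    fun _ hq _ hv => svmEnergy_hessian_pos hg hG hq hv

/-! ### Symmetric hyperbolicity -/

theorem ContDiffOn.hasFDerivAt_fderiv {E V : Type*} [NormedAddCommGroup E] [NormedSpace ℝ E]
    [NormedAddCommGroup V] [NormedSpace ℝ V] {f : E → V} {D : Set E} {q : E}
    (hf : ContDiffOn ℝ ∞ f D) (hD : IsOpen D) (hq : q ∈ D) : HasFDerivAt f (fderiv ℝ f q) q :=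
  ((hf.contDiffAt (hD.mem_nhds hq)).differentiableAt (by simp)).hasFDerivAt

theorem ContDiffOn.fderiv_fderiv_comm {E V : Type*} [NormedAddCommGroup E] [NormedSpace ℝ E]
    [NormedAddCommGroup V] [NormedSpace ℝ V] {f : E → V} {D : Set E} {q : E}
    (hf : ContDiffOn ℝ ∞ f D) (hD : IsOpen D) (hq : q ∈ D) (v w : E) :
    fderiv ℝ (fderiv ℝ f) q v w = fderiv ℝ (fderiv ℝ f) q w v := by
  have h : ContDiffAt ℝ 2 f q :=
    (hf.contDiffAt (hD.mem_nhds hq)).of_le (WithTop.coe_le_coe.2 (le_top : (2 : ℕ∞) ≤ ⊤))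
  exact (h.isSymmSndFDerivAt (by simp)).eq v w

/-- Differentiating a compatibility relation `α (β v) = δ v + ξ z` between fields of operators. -/
theorem fderiv_apply_add_eq {E W : Type*} [NormedAddCommGroup E] [NormedSpace ℝ E]
    [NormedAddCommGroup W] [NormedSpace ℝ W] {α : E → E →L[ℝ] ℝ} {β : E → E →L[ℝ] E}
    {δ : E → E →L[ℝ] ℝ} {ξ : E → W →L[ℝ] ℝ} {q : E} {α' : E →L[ℝ] E →L[ℝ] ℝ}
    {β' : E →L[ℝ] E →L[ℝ] E} {δ' : E →L[ℝ] E →L[ℝ] ℝ} {ξ' : E →L[ℝ] W →L[ℝ] ℝ}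
    (hα : HasFDerivAt α α' q) (hβ : HasFDerivAt β β' q) (hδ : HasFDerivAt δ δ' q)
    (hξ : HasFDerivAt ξ ξ' q) (v : E) (z : W)
    (h : ∀ᶠ r in nhds q, α r (β r v) = δ r v + ξ r z) (w : E) :
    α' w (β q v) + α q (β' w v) = δ' w v + ξ' w z := by
  have h1 : HasFDerivAt (fun r => α r (β r v)) _ q :=
    hα.clm_apply (hβ.clm_apply (hasFDerivAt_const v q))
  have h2 : HasFDerivAt (fun r => δ r v + ξ r z) _ q :=
    (hδ.clm_apply (hasFDerivAt_const v q)).add (hξ.clm_apply (hasFDerivAt_const z q))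
  have h3 := congrArg (fun L => L w) (h1.unique (h2.congr_of_eventuallyEq h))
  simp at h3
  linarith

/-- An entropy with positive definite Hessian symmetrizes a system with an involution. -/
theorem IsEntropyPair.isSymmetricHyperbolic {E W : Type*} [NormedAddCommGroup E]
    [NormedSpace ℝ E] [FiniteDimensional ℝ E] [NormedAddCommGroup W] [NormedSpace ℝ W]
    {F : Fin 2 → E → E} {M : Fin 2 → E →L[ℝ] W} {D : Set E} {η : E → ℝ} {Q : Fin 2 → E → ℝ}
    (hD : IsOpen D) (hF : ∀ j, ContDiffOn ℝ ∞ (F j) D) (h : IsEntropyPair F M D η Q)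
    (hpos : ∀ q ∈ D, ∀ v, v ≠ 0 → 0 < fderiv ℝ (fderiv ℝ η) q v v) :
    IsSymmetricHyperbolic F M D (fderiv ℝ (fderiv ℝ η)) := by
  obtain ⟨hη, hQ, Ξ, hΞ, hcomp⟩ := h
  have hη1 : ContDiffOn ℝ ∞ (fderiv ℝ η) D := hη.fderiv_of_isOpen hD (by simp)
  have hη2 : ContDiffOn ℝ ∞ (fderiv ℝ (fderiv ℝ η)) D := hη1.fderiv_of_isOpen hD (by simp)
  -- Positive definiteness makes the Hessian injective, hence an isomorphism onto the dual in finite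
  -- dimension. Inversion is smooth at such points, which gives the smoothness of `C`.
  have hinv : ∀ q ∈ D, ∃ e : E ≃L[ℝ] (E →L[ℝ] ℝ), (e : E →L[ℝ] E →L[ℝ] ℝ)
      = fderiv ℝ (fderiv ℝ η) q := by
    intro q hq
    have hinj : Function.Injective (fderiv ℝ (fderiv ℝ η) q) := by
      rw [injective_iff_map_eq_zero]
      intro v hv
      by_contra hne
      have := hpos q hq v hne
      simp [hv] at this
    have hfr : Module.finrank ℝ E = Module.finrank ℝ (E →L[ℝ] ℝ) := by
      rw [(LinearMap.toContinuousLinearMap (𝕜 := ℝ) (E := E) (F' := ℝ)).symm.finrank_eq]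
      exact (Subspace.dual_finrank_eq (K := ℝ) (V := E)).symm
    let e := LinearEquiv.ofInjectiveOfFinrankEq
      (fderiv ℝ (fderiv ℝ η) q : E →ₗ[ℝ] (E →L[ℝ] ℝ)) hinj hfr
    exact ⟨e.toContinuousLinearEquiv, by ext v w; rfl⟩
  refine ⟨hF, hη2, fun q hq v w => hη.fderiv_fderiv_comm hD hq v w, hpos, fun q =>
    (ContinuousLinearMap.inverse (fderiv ℝ (fderiv ℝ η) q)).comp (fderiv ℝ Ξ q).flip, ?_, ?_⟩
  · intro q hq
    obtain ⟨e, he⟩ := hinv q hq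
    have h1 : ContDiffAt ℝ ∞ ContinuousLinearMap.inverse (fderiv ℝ (fderiv ℝ η) q) := by
      rw [← he]
      exact contDiffAt_map_inverse e
    have h2 := h1.comp q (hη2.contDiffAt (hD.mem_nhds hq))
    have h3 : ContDiffAt ℝ ∞ (fun r => (fderiv ℝ Ξ r).flip) q := by
      have h4 : ContDiffAt ℝ ∞ (fderiv ℝ Ξ) q :=
        (hΞ.contDiffAt (hD.mem_nhds hq)).fderiv_right (by simp)
      have h5 : ContDiff ℝ ∞ (fun L : E →L[ℝ] W →L[ℝ] ℝ => L.flip) :=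
        (LinearIsometryEquiv.contDiff (𝕜 := ℝ) (n := ∞) (E := E →L[ℝ] W →L[ℝ] ℝ)
          (F := W →L[ℝ] E →L[ℝ] ℝ) (ContinuousLinearMap.flipₗᵢ ℝ E W ℝ) :)
      exact h5.contDiffAt.comp q h4
    exact (h2.clm_comp h3).contDiffWithinAt
  · intro q hq j
    -- The choice `C = (D²η)⁻¹ (DΞ)ᵀ` is made so that `D²η (C z, w) = (DΞ w) z`.
    have hS : ∀ z w, fderiv ℝ (fderiv ℝ η) q
        ((ContinuousLinearMap.inverse (fderiv ℝ (fderiv ℝ η) q)).comp (fderiv ℝ Ξ q).flip z) w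
        = fderiv ℝ Ξ q w z := by
      intro z w
      obtain ⟨e, he⟩ := hinv q hq
      rw [← he, ContinuousLinearMap.inverse_equiv]
      simp
    have hF1 := (hF j).fderiv_of_isOpen (m := ∞) hD (by simp)
    have hQ1 := (hQ j).fderiv_of_isOpen (m := ∞) hD (by simp)
    have main : ∀ v w, fderiv ℝ (fderiv ℝ η) q w (fderiv ℝ (F j) q v)
        + fderiv ℝ η q (fderiv ℝ (fderiv ℝ (F j)) q w v)
        = fderiv ℝ (fderiv ℝ (Q j)) q w v + fderiv ℝ Ξ q w (M j v) := by
      intro v w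
      refine fderiv_apply_add_eq (hη1.hasFDerivAt_fderiv hD hq) (hF1.hasFDerivAt_fderiv hD hq) (hQ1.hasFDerivAt_fderiv hD hq) (hΞ.hasFDerivAt_fderiv hD hq) v (M j v) ?_ w
      filter_upwards [hD.mem_nhds hq] with r hr
      exact congrArg (fun L => L v) (hcomp r hr j)
    intro v w
    rw [map_sub, map_sub, sub_apply, sub_apply, hS, hS,
      hη.fderiv_fderiv_comm hD hq _ w, hη.fderiv_fderiv_comm hD hq _ v]
    -- Antisymmetrizing in `v, w` removes the second derivatives of `Fⱼ` and `Qⱼ`, which are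
    -- symmetric; the terms with `DΞ` are those absorbed by `C`.
    linear_combination main v w - main w v
      + congrArg (fderiv ℝ η q) ((hF j).fderiv_fderiv_comm hD hq v w)
      + (hQ j).fderiv_fderiv_comm hD hq w v

theorem isSymmetricHyperbolic_svm1 {g G : ℝ} (hg : 0 < g) (hG : 0 < G) :
    IsSymmetricHyperbolic (svm1Flux g G) piolaMap AHPlus (fderiv ℝ (fderiv ℝ (svmEnergy g G))) :=
  (isEntropyPair_svmEnergy g G).isSymmetricHyperbolic isOpen_AHPlus
    (fun j _ hq => (contDiffAt_svm1Flux g G j hq).contDiffWithinAt)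
    fun _ hq _ hv => svmEnergy_hessian_pos hg hG hq hv

/-! ### Equivalence of the two systems -/

theorem svmConserved_primA {q : SvmState} (hq : q.1 ≠ 0) :
    svmConserved (primA q) = (q.1, q.2.1, q.2.2.1, fun l => q.1 * stretchCoeff q l,
      q.1 * (q.2.2.2.2 / q.1) ^ 4) := by
  refine Prod.ext rfl (Prod.ext ?_ (Prod.ext ?_ rfl))
  · funext i
    exact mul_div_cancel₀ _ hq
  · funext i α
    exact mul_div_cancel₀ _ hq

theorem svmFlux_primA (g G : ℝ) (j : Fin 2) {q : SvmState} (hq : q.1 ≠ 0) :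
    svmFlux g G j (primA q) = ((svm1Flux g G j q).1, (svm1Flux g G j q).2.1,
      (svm1Flux g G j q).2.2.1, fun l => q.2.1 j * stretchCoeff q l,
      q.2.1 j * (q.2.2.2.2 / q.1) ^ 4) := by
  have h : q.1 * (q.2.1 j / q.1) = q.2.1 j := mul_div_cancel₀ _ hq
  refine Prod.ext h (Prod.ext rfl (Prod.ext ?_ (Prod.ext ?_ ?_)))
  · funext i α
    change q.1 * (q.2.1 j / q.1) * (q.2.2.1 i α / q.1)
      - q.1 * (q.2.2.1 j α / q.1) * (q.2.1 i / q.1)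
      = q.2.1 j / q.1 * q.2.2.1 i α - q.2.2.1 j α * (q.2.1 i / q.1)
    field_simp
  · funext l
    change q.1 * (q.2.1 j / q.1) * _ = _
    rw [h]
    rfl
  · change q.1 * (q.2.1 j / q.1) * _ = _
    rw [h]
    rfl

theorem contDiffAt_svmConserved_primA {n : WithTop ℕ∞} {q : SvmState} (hq : q ∈ AHPlus) :
    ContDiffAt ℝ n (fun r => svmConserved (primA r)) q := by
  have h0 : q.1 ≠ 0 := hq.1.ne'
  refine ContDiffAt.congr_of_eventuallyEq (f := fun q : SvmState => (q.1, q.2.1, q.2.2.1,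
    fun l => q.1 * stretchCoeff q l, q.1 * (q.2.2.2.2 / q.1) ^ 4)) ?_ ?_
  · refine contDiffAt_fst.prodMk (ContDiffAt.prodMk (by fun_prop) (ContDiffAt.prodMk
      (by fun_prop) (ContDiffAt.prodMk (contDiffAt_pi.2 fun l => ?_) ?_)))
    · exact contDiffAt_fst.mul (contDiffAt_pi.1 (contDiffAt_stretchCoeff hq) l)
    · fun_prop (disch := exact h0)
  · filter_upwards [eventually_mem_AHPlus hq] with r hr using svmConserved_primA hr.1.ne'

theorem contDiffAt_svmFlux_primA {n : WithTop ℕ∞} (g G : ℝ) (j : Fin 2) {q : SvmState}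
    (hq : q ∈ AHPlus) : ContDiffAt ℝ n (fun r => svmFlux g G j (primA r)) q := by
  have h0 : q.1 ≠ 0 := hq.1.ne'
  have hF := contDiffAt_svm1Flux (n := n) g G j hq
  have hm : ContDiffAt ℝ n (fun r : SvmState => r.2.1 j) q := by fun_prop
  refine ContDiffAt.congr_of_eventuallyEq (f := fun q : SvmState => ((svm1Flux g G j q).1,
      (svm1Flux g G j q).2.1, (svm1Flux g G j q).2.2.1, fun l => q.2.1 j * stretchCoeff q l,
      q.2.1 j * (q.2.2.2.2 / q.1) ^ 4)) ?_ ?_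
  · refine hF.fst.prodMk (hF.snd.fst.prodMk (hF.snd.snd.fst.prodMk
      (ContDiffAt.prodMk (contDiffAt_pi.2 fun l => ?_) ?_)))
    · exact hm.mul (contDiffAt_pi.1 (contDiffAt_stretchCoeff hq) l)
    · fun_prop (disch := exact h0)
  · filter_upwards [eventually_mem_AHPlus hq] with r hr using svmFlux_primA g G j hr.1.ne'

theorem fderiv_svmConserved_primA {q : SvmState} (hq : q ∈ AHPlus) (v : SvmState) :
    fderiv ℝ (fun r => svmConserved (primA r)) q v = (v.1, v.2.1, v.2.2.1,
      fun l => v.1 * stretchCoeff q l + q.1 * fderiv ℝ stretchCoeff q v l,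
      4 * q.2.2.2.2 ^ 3 * v.2.2.2.2 / q.1 ^ 3 - 3 * q.2.2.2.2 ^ 4 * v.1 / q.1 ^ 4) := by
  have h0 : q.1 ≠ 0 := hq.1.ne'
  have hne : q.1 + (0 : ℝ) • v.1 ≠ 0 := by simpa using h0
  have hH : HasDerivAt (fun s : ℝ => q.1 + s • v.1) v.1 0 := hasDerivAt_line q.1 v.1 0
  have hs : HasDerivAt (fun s : ℝ => q.2.2.2.2 + s • v.2.2.2.2) v.2.2.2.2 0 :=
    hasDerivAt_line _ _ 0
  have ha := hasDerivAt_pi.1 (hasDerivAt_stretchCoeff hq v)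
  refine fderiv_apply_eq_of_line ((contDiffAt_svmConserved_primA (n := 1) hq).differentiableAt
    one_ne_zero) (h := fun s : ℝ => (q.1 + s • v.1, q.2.1 + s • v.2.1, q.2.2.1 + s • v.2.2.1,
      fun l => (q.1 + s • v.1) * stretchCoeff (q + s • v) l,
      (q.1 + s • v.1) * ((q.2.2.2.2 + s • v.2.2.2.2) / (q.1 + s • v.1)) ^ 4)) ?_ ?_
  · filter_upwards [eventually_line_mem hq v] with s hs
    exact svmConserved_primA hs.1.ne'
  · refine hH.prodMk ((hasDerivAt_line _ _ 0).prodMk ((hasDerivAt_line _ _ 0).prodMk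
      (HasDerivAt.prodMk (hasDerivAt_pi.2 fun l => ?_) ?_)))
    · refine (hH.mul (ha l)).congr_deriv ?_
      simp
    · refine (hH.mul ((hs.div hH hne).pow 4)).congr_deriv ?_
      simp
      field_simp
      ring

/-- The fluxes of the two systems are compatible with the change of variables. -/
theorem fderiv_svmFlux_primA (g G : ℝ) (j : Fin 2) {q : SvmState} (hq : q ∈ AHPlus)
    (v : SvmState) : fderiv ℝ (fun r => svmFlux g G j (primA r)) q v
      = fderiv ℝ (fun r => svmConserved (primA r)) q (fderiv ℝ (svm1Flux g G j) q v) := by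
  have h0 : q.1 ≠ 0 := hq.1.ne'
  have hne : q.1 + (0 : ℝ) • v.1 ≠ 0 := by simpa using h0
  have hH : HasDerivAt (fun s : ℝ => q.1 + s • v.1) v.1 0 := hasDerivAt_line q.1 v.1 0
  have hm : HasDerivAt (fun s : ℝ => q.2.1 j + s • v.2.1 j) (v.2.1 j) 0 :=
    hasDerivAt_line _ _ 0
  have hs : HasDerivAt (fun s : ℝ => q.2.2.2.2 + s • v.2.2.2.2) v.2.2.2.2 0 :=
    hasDerivAt_line _ _ 0
  have ha := hasDerivAt_pi.1 (hasDerivAt_stretchCoeff hq v)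
  have hF := ((contDiffAt_svm1Flux (n := 1) g G j hq).differentiableAt one_ne_zero).hasFDerivAt
  -- On the `HA` and `HAcc` components both sides must be computed; the advection of `A` in `e2`
  -- reconciles them. The other components of the change of variables are the identity.
  have e1 := fderiv_svm1Flux g G j hq v
  have e2 : fderiv ℝ stretchCoeff q (fderiv ℝ (svm1Flux g G j) q v)
      = (q.2.1 j / q.1) • fderiv ℝ stretchCoeff q v := by
    rw [e1, fderiv_stretchCoeff_fluxDeriv g G j hq]
  rw [fderiv_svmConserved_primA hq, e2]
  refine fderiv_apply_eq_of_line ((contDiffAt_svmFlux_primA (n := 1) g G j hq).differentiableAt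
    one_ne_zero) (h := fun s : ℝ => ((svm1Flux g G j (q + s • v)).1,
      (svm1Flux g G j (q + s • v)).2.1, (svm1Flux g G j (q + s • v)).2.2.1,
      fun l => (q.2.1 j + s • v.2.1 j) * stretchCoeff (q + s • v) l,
      (q.2.1 j + s • v.2.1 j) * ((q.2.2.2.2 + s • v.2.2.2.2) / (q.1 + s • v.1)) ^ 4)) ?_ ?_
  · filter_upwards [eventually_line_mem hq v] with s hs
    exact svmFlux_primA g G j hs.1.ne'
  · refine HasDerivAt.prodMk hF.fst.hasDerivAt_line (HasDerivAt.prodMk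
      hF.snd.fst.hasDerivAt_line (HasDerivAt.prodMk hF.snd.snd.fst.hasDerivAt_line
      (HasDerivAt.prodMk (hasDerivAt_pi.2 fun l => ?_) ?_)))
    · refine (hm.mul (ha l)).congr_deriv ?_
      simp [e1, fluxDeriv]
      field_simp
    · refine (hm.mul ((hs.div hH hne).pow 4)).congr_deriv ?_
      simp [e1, fluxDeriv]
      field_simp
      ring

/-! ### Source terms under the change of variables -/

theorem matZ_eq (q : SvmState) : matZ q = ((primA q).matᵀ * (primA q).mat)⁻¹
    * symMat (stretchCoeff q)
      + symMat (stretchCoeff q) * ((primA q).matᵀ * (primA q).mat)⁻¹ := rfl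

theorem cauchyGreen_inv_transpose (F : Matrix (Fin 2) (Fin 2) ℝ) : ((Fᵀ * F)⁻¹)ᵀ = (Fᵀ * F)⁻¹ := by
  rw [Matrix.transpose_nonsing_inv, Matrix.transpose_mul, Matrix.transpose_transpose]

/-- If `H` does not vary, the variation of `Y` is that of `HY` divided by `H`. This is then
`fderiv_invSqrtCoeff_eq_iff` with target `(FᵀF)⁻¹` and rate `1 / λ`. -/
theorem fderiv_stretchCoeff_eq_iff {q : SvmState} (hq : q ∈ AHPlus) {v : SvmState} (hv : v.1 = 0)
    (lam : ℝ) : fderiv ℝ stretchCoeff q v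
        = symEntries (lam⁻¹ • (((primA q).matᵀ * (primA q).mat)⁻¹ - (primA q).sym)) ↔
      v.2.2.2.1 = symEntries (-(q.1 / lam) • relaxY q) := by
  have h0 : q.1 ≠ 0 := hq.1.ne'
  rw [fderiv_stretchCoeff hq]
  have := fderiv_invSqrtCoeff_eq_iff hq.2.1
    (fun l => (v.2.2.2.1 l - q.2.2.2.1 l / q.1 * v.1) / q.1)
    (cauchyGreen_inv_transpose (primA q).mat) lam⁻¹
  refine this.trans ?_
  have e : ∀ (c : ℝ) (M : Matrix (Fin 2) (Fin 2) ℝ), symEntries (c • M) = c • symEntries M := by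
    intro c M
    ext l
    fin_cases l <;> rfl
  rw [e, e]
  change _ = -lam⁻¹ • symEntries (relaxY q) ↔ _
  simp only [funext_iff, hv, mul_zero, sub_zero, Pi.smul_apply, smul_eq_mul]
  refine forall_congr' fun l => ?_
  rw [div_eq_iff h0]
  have : -lam⁻¹ * symEntries (relaxY q) l * q.1 = -(q.1 / lam) * symEntries (relaxY q) l := by
    ring
  rw [this]

/-- The change of variables maps the source of one system to the source of the other. -/
theorem fderiv_svmConserved_primA_eq_source_iff (g k lam : ℝ) (hlam : 0 < lam) (s : Fin 2 → ℝ)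
    {q : SvmState} (hq : q ∈ AHPlus) (v : SvmState) :
    fderiv ℝ (fun r => svmConserved (primA r)) q v = svmSource g k lam s (primA q)
      ↔ v = svm1Source g k lam s q := by
  have h0 : q.1 ≠ 0 := hq.1.ne'
  have hs0 : q.2.2.2.2 ≠ 0 := ((mem_AHPlus_iff q).1 hq).2.2.ne'
  rw [fderiv_svmConserved_primA hq]
  simp only [Prod.ext_iff, svmSource, svm1Source]
  refine and_congr_right fun hv => and_congr ?_ (and_congr Iff.rfl (and_congr ?_ ?_))
  · have : (fun i => -g * (primA q).depth * s i - k * (primA q).depth * (primA q).vec i)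
        = fun i => -g * q.depth * s i - k * q.vec i := by
      funext i
      change -g * q.1 * s i - k * q.1 * (q.2.1 i / q.1) = -g * q.1 * s i - k * q.2.1 i
      field_simp
    rw [this]
  · rw [show q.depth = q.1 from rfl, ← fderiv_stretchCoeff_eq_iff hq hv lam]
    simp only [funext_iff, hv, zero_mul, zero_add]
    refine forall_congr' fun l => ?_
    have e : symEntries (((primA q).depth / lam) • (((primA q).matᵀ * (primA q).mat)⁻¹
          - (primA q).sym)) l
        = q.1 * symEntries (lam⁻¹ • (((primA q).matᵀ * (primA q).mat)⁻¹ - (primA q).sym)) l := by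
      have e1 : ((primA q).depth / lam) = q.1 * lam⁻¹ := div_eq_mul_inv _ _
      rw [e1, mul_smul]
      fin_cases l <;> rfl
    rw [e, mul_right_inj' h0]
  · change 4 * q.2.2.2.2 ^ 3 * v.2.2.2.2 / q.1 ^ 3 - 3 * q.2.2.2.2 ^ 4 * v.1 / q.1 ^ 4
      = q.1 * (1 / q.1 ^ 2 - (q.2.2.2.2 / q.1) ^ 4) / lam ↔ v.2.2.2.2
      = q.1 * (1 / (q.1 ^ 2 * (q.2.2.2.2 / q.1) ^ 3) - q.2.2.2.2 / q.1) / (4 * lam)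
    have hl := hlam.ne'
    rw [hv]
    -- The factor `4 s³ / H³` is the derivative of `H (s/H)⁴` in `s`. It is nonzero, so it can be
    -- cancelled.
    have e : q.1 * (1 / q.1 ^ 2 - (q.2.2.2.2 / q.1) ^ 4) / lam = 4 * q.2.2.2.2 ^ 3 / q.1 ^ 3
        * (q.1 * (1 / (q.1 ^ 2 * (q.2.2.2.2 / q.1) ^ 3) - q.2.2.2.2 / q.1) / (4 * lam)) := by
      field_simp
    rw [e, mul_zero, zero_div, sub_zero, mul_div_right_comm]
    exact mul_right_inj' (by positivity)

theorem dt_comp {E V : Type*} [NormedAddCommGroup E] [NormedSpace ℝ E] [NormedAddCommGroup V]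
    [NormedSpace ℝ V] {f : E → V} {q : SpaceTime → E} {x : SpaceTime}
    (hf : DifferentiableAt ℝ f (q x)) (hq : DifferentiableAt ℝ q x) :
    dt (fun y => f (q y)) x = fderiv ℝ f (q x) (dt q x) := by
  rw [dt, dt, fderiv_fun_comp x hf hq]
  rfl

theorem dx_comp {E V : Type*} [NormedAddCommGroup E] [NormedSpace ℝ E] [NormedAddCommGroup V]
    [NormedSpace ℝ V] {f : E → V} {q : SpaceTime → E} {x : SpaceTime} (j : Fin 2)
    (hf : DifferentiableAt ℝ f (q x)) (hq : DifferentiableAt ℝ q x) :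
    dx j (fun y => f (q y)) x = fderiv ℝ f (q x) (dx j q x) := by
  rw [dx, dx, fderiv_fun_comp x hf hq]
  rfl

/-- The two systems are equivalent at each point of differentiability. -/
theorem svm_equation_iff (g G k lam : ℝ) (hlam : 0 < lam) (s : Fin 2 → ℝ)
    {q : SpaceTime → SvmState} {x : SpaceTime} (hd : DifferentiableAt ℝ q x)
    (hq : q x ∈ AHPlus) :
    dt (fun y => svmConserved (primA (q y))) x
        + ∑ j, dx j (fun y => svmFlux g G j (primA (q y))) x = svmSource g k lam s (primA (q x))
      ↔ dt q x + ∑ j, dx j (fun y => svm1Flux g G j (q y)) x = svm1Source g k lam s (q x) := by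
  rw [← fderiv_svmConserved_primA_eq_source_iff g k lam hlam s hq, map_add, map_sum]
  have h1 := dt_comp (f := fun r => svmConserved (primA r))
    ((contDiffAt_svmConserved_primA (n := 1) hq).differentiableAt one_ne_zero) hd
  have h2 := fun j => dx_comp (f := fun r => svmFlux g G j (primA r)) j
    ((contDiffAt_svmFlux_primA (n := 1) g G j hq).differentiableAt one_ne_zero) hd
  have h3 := fun j => dx_comp (f := svm1Flux g G j) j
    ((contDiffAt_svm1Flux (n := 1) g G j hq).differentiableAt one_ne_zero) hd
  simp only [h1, h2, h3, fderiv_svmFlux_primA g G _ hq]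

/-! ### Correspondence of the solutions -/

theorem dt_congr {E : Type*} [NormedAddCommGroup E] [NormedSpace ℝ E] {f h : SpaceTime → E}
    {x : SpaceTime} (he : f =ᶠ[nhds x] h) : dt f x = dt h x := by
  rw [dt, dt, he.fderiv_eq]

theorem dx_congr {E : Type*} [NormedAddCommGroup E] [NormedSpace ℝ E] {f h : SpaceTime → E}
    {x : SpaceTime} (j : Fin 2) (he : f =ᶠ[nhds x] h) : dx j f x = dx j h x := by
  rw [dx, dx, he.fderiv_eq]

theorem PiolaOn.congr {O : Set SpaceTime} (hO : IsOpen O)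
    {V W : SpaceTime → Matrix (Fin 2) (Fin 2) ℝ} (hV : PiolaOn O V) (h : ∀ x ∈ O, W x = V x) :
    PiolaOn O W := by
  intro x hx α
  rw [← hV x hx α]
  refine Finset.sum_congr rfl fun j _ => dx_congr j ?_
  filter_upwards [hO.mem_nhds hx] with y hy
  rw [h y hy]

section Solutions

variable {g G k lam : ℝ} {zb : (Fin 2 → ℝ) → ℝ} {n : ℕ∞} {O : Set SpaceTime}

theorem IsSvm1Solution.differentiableAt {q : SpaceTime → SvmState}
    (h : IsSvm1Solution g G k lam zb n O q) (hn : 1 ≤ n) (hO : IsOpen O) {x : SpaceTime}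
    (hx : x ∈ O) : DifferentiableAt ℝ q x :=
  (h.smooth.contDiffAt (hO.mem_nhds hx)).differentiableAt (by
    intro h0
    rw [WithTop.coe_eq_zero] at h0
    simp [h0] at hn)

theorem IsSvmSolution.differentiableAt {p : SpaceTime → SvmState}
    (h : IsSvmSolution g G k lam zb n O p) (hn : 1 ≤ n) (hO : IsOpen O) {x : SpaceTime}
    (hx : x ∈ O) : DifferentiableAt ℝ p x :=
  (h.smooth.contDiffAt (hO.mem_nhds hx)).differentiableAt (by
    intro h0
    rw [WithTop.coe_eq_zero] at h0
    simp [h0] at hn)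

theorem IsSvm1Solution.primA (hlam : 0 < lam) (hn : 1 ≤ n) (hO : IsOpen O)
    {q : SpaceTime → SvmState} (h : IsSvm1Solution g G k lam zb n O q) :
    IsSvmSolution g G k lam zb n O (fun y => _root_.primA (q y)) where
  smooth x hx := (contDiffAt_primA (h.admissible x hx)).comp_contDiffWithinAt x (h.smooth x hx)
  admissible x hx := primA_mem (h.admissible x hx)
  invertible := h.invertible
  equation x hx := (svm_equation_iff g G k lam hlam _ (h.differentiableAt hn hO hx)
    (h.admissible x hx)).2 (h.equation x hx)

theorem IsSvmSolution.consOfPrim (hlam : 0 < lam) (hn : 1 ≤ n) (hO : IsOpen O)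
    {p : SpaceTime → SvmState} (h : IsSvmSolution g G k lam zb n O p) :
    IsSvm1Solution g G k lam zb n O (fun y => _root_.consOfPrim (p y)) where
  smooth x hx :=
    (contDiffAt_consOfPrim (h.admissible x hx)).comp_contDiffWithinAt x (h.smooth x hx)
  admissible x hx := consOfPrim_mem (h.admissible x hx)
  invertible x hx := by
    rw [primY_consOfPrim (h.admissible x hx).1]
    exact h.invertible x hx
  equation x hx := by
    have hp := h.admissible x hx
    have hd : DifferentiableAt ℝ (fun y => _root_.consOfPrim (p y)) x :=
      ((contDiffAt_consOfPrim (n := 1) hp).differentiableAt one_ne_zero).comp x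
        (h.differentiableAt hn hO hx)
    -- The round trip is the identity only where `p` is admissible; openness of `O` makes this
    -- enough for derivatives at `x`.
    have he : ∀ᶠ y in nhds x, _root_.primA (_root_.consOfPrim (p y)) = p y := by
      filter_upwards [hO.mem_nhds hx] with y hy using primA_consOfPrim (h.admissible y hy)
    refine (svm_equation_iff g G k lam hlam _ hd (consOfPrim_mem hp)).1 ?_
    rw [primA_consOfPrim hp, ← h.equation x hx]
    congr 1
    · exact dt_congr (he.mono fun y hy => by simp only [hy])
    · exact Finset.sum_congr rfl fun j _ => dx_congr j (he.mono fun y hy => by simp only [hy])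

theorem bijOn_svm1Solutions (hlam : 0 < lam) (hn : 1 ≤ n) (hO : IsOpen O) :
    Set.BijOn (fun (q : O → SvmState) (x : O) => primA (q x))
      (Svm1Solutions g G k lam zb n O) (SvmSolutions g G k lam zb n O) := by
  refine ⟨?_, ?_, ?_⟩
  · rintro _ ⟨q, hq, rfl⟩
    exact ⟨fun y => primA (q y), hq.primA hlam hn hO, rfl⟩
  · rintro _ ⟨q, hq, rfl⟩ _ ⟨r, hr, rfl⟩ h
    funext x
    exact bijOn_primA.injOn (hq.admissible x x.2) (hr.admissible x x.2) (congrFun h x)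
  · rintro _ ⟨p, hp, rfl⟩
    refine ⟨_, ⟨fun y => consOfPrim (p y), hp.consOfPrim hlam hn hO, rfl⟩, ?_⟩
    funext x
    exact primA_consOfPrim (hp.admissible x x.2)

theorem bijOn_svm1Motions (hlam : 0 < lam) (hn : 1 ≤ n) (hO : IsOpen O) (Hhat : ℝ) :
    Set.BijOn (fun (q : O → SvmState) (x : O) => primA (q x))
      (Svm1Motions g G k lam zb Hhat n O) (SvmMotions g G k lam zb Hhat n O) := by
  refine ⟨?_, ?_, ?_⟩
  · rintro _ ⟨q, ⟨hq, hP, hH⟩, rfl⟩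
    refine ⟨fun y => primA (q y), ⟨hq.primA hlam hn hO, hP.congr hO fun x hx => ?_, hH⟩, rfl⟩
    ext i α
    exact mul_div_cancel₀ _ (hq.admissible x hx).1.ne'
  · rintro _ ⟨q, ⟨hq, -⟩, rfl⟩ _ ⟨r, ⟨hr, -⟩, rfl⟩ h
    funext x
    exact bijOn_primA.injOn (hq.admissible x x.2) (hr.admissible x x.2) (congrFun h x)
  · rintro _ ⟨p, ⟨hp, hP, hH⟩, rfl⟩
    refine ⟨_, ⟨fun y => consOfPrim (p y), ⟨hp.consOfPrim hlam hn hO,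
      hP.congr hO fun x hx => rfl, fun x hx => ?_⟩, rfl⟩, ?_⟩
    · rw [primY_consOfPrim (hp.admissible x hx).1]
      exact hH x hx
    · funext x
      exact primA_consOfPrim (hp.admissible x x.2)

end Solutions

/-! ### The balance law -/

/-- The product collapses to the identity. Its trace supplies two of the three `G` subtracted in the
dissipation; the vertical relaxation supplies the third. -/
theorem trace_mul_congr_inv {F : Matrix (Fin 2) (Fin 2) ℝ} (hF : F.det ≠ 0) :
    (F * (Fᵀ * F)⁻¹ * Fᵀ).trace = 2 := by
  have hF' : IsUnit F.det := hF.isUnit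
  have hFt : IsUnit Fᵀ.det := by rwa [Matrix.det_transpose]
  rw [Matrix.mul_inv_rev, ← Matrix.mul_assoc, Matrix.mul_nonsing_inv F hF', Matrix.one_mul,
    Matrix.nonsing_inv_mul _ hFt, Matrix.trace_one]
  simp

theorem relaxY_transpose (q : SvmState) : (relaxY q)ᵀ = relaxY q := by
  have hY : ((primY q).sym)ᵀ = (primY q).sym := symMat_transpose (primY q).symCoeff
  have hA := symMat_transpose (stretchCoeff q)
  rw [relaxY, matZ_eq]
  simp only [Matrix.transpose_mul, Matrix.transpose_sub, Matrix.transpose_add,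
    Matrix.transpose_smul, Matrix.transpose_nonsing_inv, Matrix.transpose_transpose, hY, hA,
    Matrix.mul_assoc]
  rw [add_comm (symMat (stretchCoeff q) * _)]

/-- The source leaves `H` and `HF` fixed and makes `A` relax linearly, so the stress energy changes
at rate `-H (tr Σᴴ - 2G) / (2λ)`. The vertical part gives `-H (Σᶻᶻ - G) / (2λ)`, and the added
`tr(YY)` gives the remaining trace. -/
theorem energyDeriv_source (g G k lam : ℝ) (hlam : 0 < lam) (s : Fin 2 → ℝ) {q : SvmState}
    (hq : q ∈ AHPlus) (hF : (primA q).mat.det ≠ 0) :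
    fderiv ℝ (svmEnergy g G) q (svm1Source g k lam s q)
      = -k * q.depth * ∑ i, (primA q).vec i ^ 2 - g * q.depth * ∑ i, (primA q).vec i * s i
        - q.depth * svmDissipation G lam q := by
  have h0 : q.1 ≠ 0 := hq.1.ne'
  have hs0 : q.2.2.2.2 ≠ 0 := ((mem_AHPlus_iff q).1 hq).2.2.ne'
  have hl := hlam.ne'
  have ha := (fderiv_stretchCoeff_eq_iff hq (v := svm1Source g k lam s q) rfl lam).2 rfl
  rw [fderiv_svmEnergy g G hq, ha]
  set C := ((primA q).matᵀ * (primA q).mat)⁻¹ with hC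
  have hCt : C 1 0 = C 0 1 := congrFun (congrFun (cauchyGreen_inv_transpose (primA q).mat) 0) 1
  have htr := trace_mul_congr_inv hF
  have hRt : (relaxY q) 1 0 = (relaxY q) 0 1 := congrFun (congrFun (relaxY_transpose q) 0) 1
  have h1 : (stressH G (primA q)).trace = G * (congrEntry q.2.2.1 (stretchCoeff q) 0 0
      + congrEntry q.2.2.1 (stretchCoeff q) 1 1) / q.1 ^ 2 := by
    simp only [stressH, Matrix.trace_fin_two, Matrix.smul_apply, mat_mul_sym_primA, smul_eq_mul]
    ring
  have h2 : stressZZ G (primA q) = G * (q.2.2.2.2 / q.1) ^ 4 * q.1 ^ 2 := rfl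
  have h3 : ((primY q).sym * relaxY q).trace = (q.2.2.2.1 0 * relaxY q 0 0
      + 2 * q.2.2.2.1 1 * relaxY q 0 1 + q.2.2.2.1 2 * relaxY q 1 1) / q.1 := by
    simp only [Matrix.trace_fin_two, Matrix.mul_apply, Fin.sum_univ_two, SvmState.sym,
      SvmState.symCoeff, primY, Matrix.of_apply, Matrix.cons_val, SvmState.depth, hRt]
    ring
  have h4 : (q.2.2.1 0 0 * (C 0 0 * q.2.2.1 0 0 + C 0 1 * q.2.2.1 0 1)
      + q.2.2.1 0 1 * (C 0 1 * q.2.2.1 0 0 + C 1 1 * q.2.2.1 0 1)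
      + (q.2.2.1 1 0 * (C 0 0 * q.2.2.1 1 0 + C 0 1 * q.2.2.1 1 1)
      + q.2.2.1 1 1 * (C 0 1 * q.2.2.1 1 0 + C 1 1 * q.2.2.1 1 1))) = 2 * q.1 ^ 2 := by
    have hm : ∀ i α, (primA q).mat i α = q.2.2.1 i α / q.1 := fun _ _ => rfl
    rw [← htr, ← hC]
    simp only [Matrix.trace_fin_two, Matrix.mul_apply, Fin.sum_univ_two, Matrix.transpose_apply,
      hCt, hm]
    field_simp
  have h5 : ∀ i, (primA q).vec i = q.2.1 i / q.1 := fun _ => rfl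
  have hsrc : svm1Source g k lam s q = (0, fun i => -g * q.1 * s i - k * q.2.1 i, 0,
      ![-(q.1 / lam) * relaxY q 0 0, -(q.1 / lam) * relaxY q 0 1, -(q.1 / lam) * relaxY q 1 1],
      q.1 * (1 / (q.1 ^ 2 * (q.2.2.2.2 / q.1) ^ 3) - q.2.2.2.2 / q.1) / (4 * lam)) := rfl
  have hb : symEntries (lam⁻¹ • (C - (primA q).sym)) = ![lam⁻¹ * (C 0 0 - stretchCoeff q 0),
      lam⁻¹ * (C 0 1 - stretchCoeff q 1), lam⁻¹ * (C 1 1 - stretchCoeff q 2)] := rfl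
  have hT : congrEntryDeriv q.2.2.1 0 (stretchCoeff q) (symEntries (lam⁻¹ • (C - (primA q).sym)))
      0 0 + congrEntryDeriv q.2.2.1 0 (stretchCoeff q)
        (symEntries (lam⁻¹ • (C - (primA q).sym))) 1 1
      = lam⁻¹ * (2 * q.1 ^ 2 - (congrEntry q.2.2.1 (stretchCoeff q) 0 0
        + congrEntry q.2.2.1 (stretchCoeff q) 1 1)) := by
    rw [hb]
    simp only [congrEntryDeriv, congrEntry, Matrix.cons_val, Pi.zero_apply]
    linear_combination lam⁻¹ * h4
  rw [energyDeriv, hsrc]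
  simp only
  rw [hT, svmDissipation, h1, h2, h3]
  simp only [Fin.sum_univ_two, h5, Matrix.cons_val]
  rw [show q.depth = q.1 from rfl]
  field_simp
  ring

/-- The differential of the functional is applied to the equation. Since the multiplier does not
depend on `j`, the extra terms sum to its value at the Piola divergence, which is zero. -/
theorem svm1_balance_law (g G k lam : ℝ) (hlam : 0 < lam) {zb : (Fin 2 → ℝ) → ℝ} {n : ℕ∞}
    (hn : 1 ≤ n) {O : Set SpaceTime} (hO : IsOpen O) {q : SpaceTime → SvmState}
    (h : IsSvm1Solution g G k lam zb n O q) (hP : PiolaOn O (fun y => (q y).mat))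
    {x : SpaceTime} (hx : x ∈ O) :
    dt (fun y => svmEnergy g G (q y)) x + ∑ j, dx j (fun y => svmEnergyFlux g G j (q y)) x
      = -k * (q x).depth * ∑ i, (primA (q x)).vec i ^ 2
        - g * (q x).depth * ∑ i, (primA (q x)).vec i * topoSlope zb x i
        - (q x).depth * svmDissipation G lam (q x) := by
  have hq := h.admissible x hx
  have hd := h.differentiableAt hn hO hx
  rw [← energyDeriv_source g G k lam hlam (topoSlope zb x) hq (h.invertible x hx),
    ← h.equation x hx, map_add, map_sum]
  have h1 := dt_comp ((contDiffAt_svmEnergy (n := 1) g G hq).differentiableAt one_ne_zero) hd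
  have h2 := fun j => dx_comp (f := svmEnergyFlux g G j) j
    ((contDiffAt_svmEnergyFlux (n := 1) g G j hq).differentiableAt one_ne_zero) hd
  have h3 := fun j => dx_comp (f := svm1Flux g G j) j
    ((contDiffAt_svm1Flux (n := 1) g G j hq).differentiableAt one_ne_zero) hd
  have h4 : ∀ j, fderiv ℝ (svmEnergy g G) (q x) (fderiv ℝ (svm1Flux g G j) (q x) (dx j q x))
      = fderiv ℝ (svmEnergyFlux g G j) (q x) (dx j q x)
        + piolaMultiplier G (q x) (piolaMap j (dx j q x)) := fun j =>
    congrArg (fun L => L (dx j q x)) (svmEnergy_compatible g G hq j)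
  have h5 : ∑ j, piolaMap j (dx j q x) = 0 := by
    funext α
    rw [Finset.sum_apply, Pi.zero_apply, ← hP x hx α]
    refine Finset.sum_congr rfl fun j _ => ?_
    let L : SvmState →L[ℝ] ℝ :=
      (ContinuousLinearMap.proj (R := ℝ) (φ := fun _ : Fin 2 => ℝ) α).comp (piolaMap j)
    have := dx_comp (f := L) j L.differentiableAt hd
    rw [L.fderiv] at this
    exact this.symm
  simp only [h1, h2, h3, h4, Finset.sum_add_distrib]
  rw [← map_sum, h5, map_zero, add_zero]

/-! ### The sign of the source term -/

/-- At `H = Hhat`, `F = A = Y = I` one has `Z = 2I`, so the term in `Y` vanishes and `tr Σᴴ = 2G`.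
Taking `Acc = c / Hhat²` makes `Σᶻᶻ = G c`, and the sign is that of `c - 1`. -/
theorem exists_svmDissipation_eq (G lam : ℝ) {Hhat c : ℝ} (hH : 0 < Hhat) (hc : 0 < c) :
    ∃ q ∈ AHPlus, q.depth * (primY q).mat.det = Hhat
      ∧ svmDissipation G lam q = G * (c - 1) / (2 * lam) := by
  let p : SvmState := (Hhat, 0, fun i α => (1 : Matrix (Fin 2) (Fin 2) ℝ) i α, ![1, 0, 1],
    c / Hhat ^ 2)
  have hsym : p.sym = 1 := by
    ext i j
    fin_cases i <;> fin_cases j <;> rfl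
  have hmat : p.mat = 1 := rfl
  have hp : p ∈ SvmAdmissible := by
    refine ⟨hH, ?_, ?_⟩
    · rw [hsym]
      exact Matrix.PosDef.one
    · change 0 < c / Hhat ^ 2
      positivity
  have hA := primA_consOfPrim hp
  have hY : (primY (consOfPrim p)).sym = 1 := by
    rw [primY_consOfPrim hp.1]
    change symMat (invSqCoeff ![1, 0, 1]) = 1
    ext i j
    fin_cases i <;> fin_cases j <;> simp [symMat, invSqCoeff]
  refine ⟨consOfPrim p, consOfPrim_mem hp, ?_, ?_⟩
  · change Hhat * (primA (consOfPrim p)).mat.det = Hhat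
    rw [hA, hmat, Matrix.det_one, mul_one]
  · have hR : relaxY (consOfPrim p) = 0 := by
      rw [relaxY, matZ, hA, hY, hmat, hsym]
      simp only [Matrix.transpose_one, mul_one, inv_one, one_mul]
      rw [two_smul, sub_self]
    have hZ : stressZZ G p = G * (c / Hhat ^ 2) * Hhat ^ 2 := rfl
    rw [svmDissipation, hR, hA, stressH, hmat, hsym, hZ]
    simp
    field_simp
    ring

end

theorem proposition8 (g G k lam : ℝ) (hg : 0 < g) (hG : 0 < G) (hk : 0 ≤ k) (hlam : 0 < lam)
    (zb : (Fin 2 → ℝ) → ℝ) (hzb : Differentiable ℝ zb) :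
    -- bijection between the smooth solutions of the two systems
    (∀ (n : ℕ∞), 1 ≤ n → ∀ O : Set SpaceTime, IsOpen O →
      Set.BijOn (fun (q : O → SvmState) (x : O) => primA (q x))
        (Svm1Solutions g G k lam zb n O) (SvmSolutions g G k lam zb n O)) ∧
    -- and between those which satisfy the Piola identities and `H |F| = Hhat`
    (∀ (n : ℕ∞), 1 ≤ n → ∀ O : Set SpaceTime, IsOpen O → ∀ Hhat : ℝ, 0 < Hhat →
      Set.BijOn (fun (q : O → SvmState) (x : O) => primA (q x))
        (Svm1Motions g G k lam zb Hhat n O) (SvmMotions g G k lam zb Hhat n O)) ∧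
    -- the state domain is open, and it is also the domain `H > 0`, `A = Aᵀ > 0`, `Acc > 0`
    IsOpen AHPlus ∧ Set.BijOn primA AHPlus SvmAdmissible ∧
    -- strict convexity
    StrictConvexOn ℝ AHPlus (svmEnergy g G) ∧
    -- balance law
    (∀ (n : ℕ∞), 1 ≤ n → ∀ O : Set SpaceTime, IsOpen O → ∀ q : SpaceTime → SvmState,
      IsSvm1Solution g G k lam zb n O q → PiolaOn O (fun y => (q y).mat) →
      ∀ x ∈ O, dt (fun y => svmEnergy g G (q y)) x
          + ∑ j, dx j (fun y => svmEnergyFlux g G j (q y)) x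
        = -k * (q x).depth * ∑ i, (primA (q x)).vec i ^ 2
          - g * (q x).depth * ∑ i, (primA (q x)).vec i * topoSlope zb x i
          - (q x).depth * svmDissipation G lam (q x)) ∧
    -- the source term of the balance law has no sign
    (∀ Hhat : ℝ, 0 < Hhat →
      (∃ q ∈ AHPlus, q.depth * (primY q).mat.det = Hhat ∧ svmDissipation G lam q < 0) ∧
      (∃ q ∈ AHPlus, q.depth * (primY q).mat.det = Hhat ∧ 0 < svmDissipation G lam q)) ∧
    -- the functional is a mathematical entropy, with a strictly convex extension
    IsInvolution (svm1Flux g G) (svm1Source g k lam) piolaMap AHPlus ∧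
    IsEntropyPair (svm1Flux g G) piolaMap AHPlus (svmEnergy g G) (svmEnergyFlux g G) ∧
    -- symmetric hyperbolicity, the Hessian of the functional being the symmetrizer
    IsSymmetricHyperbolic (svm1Flux g G) piolaMap AHPlus
      (fderiv ℝ (fderiv ℝ (svmEnergy g G))) := by
  refine ⟨fun n hn O hO => bijOn_svm1Solutions hlam hn hO,
    fun n hn O hO Hhat _ => bijOn_svm1Motions hlam hn hO Hhat, isOpen_AHPlus, bijOn_primA,
    strictConvexOn_svmEnergy hg hG,
    fun n hn O hO q hq hP x hx => svm1_balance_law g G k lam hlam hn hO hq hP hx,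
    fun Hhat hH => ⟨?_, ?_⟩, isInvolution_piolaMap g G k lam, isEntropyPair_svmEnergy g G,
    isSymmetricHyperbolic_svm1 hg hG⟩
  · obtain ⟨q, hq, h1, h2⟩ := exists_svmDissipation_eq G lam hH (c := 1 / 2) (by norm_num)
    refine ⟨q, hq, h1, ?_⟩
    rw [h2]
    exact div_neg_of_neg_of_pos (mul_neg_of_pos_of_neg hG (by norm_num)) (by positivity)
  · obtain ⟨q, hq, h1, h2⟩ := exists_svmDissipation_eq G lam hH (c := 2) (by norm_num)
    refine ⟨q, hq, h1, ?_⟩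
    rw [h2]
    exact div_pos (mul_pos hG (by norm_num)) (by positivity)
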